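/- Let $\mathbb T^n=(\mathbb R/2\pi\mathbb Z)^n$, and let $\mathrm{SVect}(\mathbb T^d)$ be the space of smooth divergence-free vector fields on $\mathbb T^d$ with its $C^\infty$ topology. Assume that $d=3$ or that $d\ge 2$ is even. Then for every $N\ge 1$ and every $\nu\in\mathbb R^N\setminus\{0\}$ there is a smooth embedding $U:\mathbb T^N\to \mathrm{SVect}(\mathbb T^d)$ (that is, a smooth map which has injective differential at every point and is a homeomorphism onto its image) such that: 1. $U$ is non-symmetric: for every $\theta\in\mathbb T^N$ and every $a\in\mathbb R^d\setminus\{0\}$, the field $U(\theta)$ is not invariant under the one-parameter group of translations $x\mapsto x+sa$, $s\in\mathbb R$. 2. For every $\theta\in\mathbb T^N$, the solution of the incompressible Euler equations $$\partial_t u+u\cdot\nabla u+\nabla p=0,\qquad \operatorname{div}u=0\qquad\text{on }\mathbb T^d$$ with initial datum $U(\theta)$ is $u(t,\cdot)=U(\theta+\nu t)$. That is, $t\mapsto U(\theta+\nu t)$ is, with a suitable smooth pressure on $\mathbb T^d$, a smooth solution for all $t\in\mathbb R$, and any smooth solution (with smooth pressure on $\mathbb T^d$) with the same initial datum on a time interval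 containing $0$ coincides with it on that interval. -/

import Mathlib

open Filter Topology
open scoped ContDiff

noncomputable section

namespace EulerTorus

/-- The space `ℝⁿ` with its Euclidean structure. -/
abbrev Space (n : ℕ) : Type := EuclideanSpace ℝ (Fin n)

/-- The flat torus `𝕋ⁿ = (ℝ / 2πℤ)ⁿ`. -/
abbrev Torus (n : ℕ) : Type := Fin n → AddCircle (2 * Real.pi)

/-- The covering projection `ℝⁿ → 𝕋ⁿ`. -/
def proj {n : ℕ} (x : Space n) : Torus n := fun i => ((x i : ℝ) : AddCircle (2 * Real.pi))

/-- The divergence of a vector field on `ℝᵈ`. -/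
def divergence {d : ℕ} (u : Space d → Space d) (x : Space d) : ℝ :=
  ∑ i, (fderiv ℝ u x (EuclideanSpace.single i 1)) i

/-- The smooth divergence-free vector fields on `𝕋ᵈ`, as a linear subspace of all vector fields
(smoothness and divergence are read off from the `2πℤᵈ`-periodic lift to `ℝᵈ`). -/
def solenoidal (d : ℕ) : Submodule ℝ (Torus d → Space d) where
  carrier := {u | ContDiff ℝ ∞ (fun x => u (proj x)) ∧
    ∀ x, divergence (fun x => u (proj x)) x = 0}
  add_mem' := by
    rintro u v ⟨hu, hu'⟩ ⟨hv, hv'⟩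
    refine ⟨hu.add hv, fun x => ?_⟩
    have h1 := (hu.differentiable (by simp)) x
    have h2 := (hv.differentiable (by simp)) x
    have h : fderiv ℝ (fun x => (u + v) (proj x)) x =
        fderiv ℝ (fun x => u (proj x)) x + fderiv ℝ (fun x => v (proj x)) x :=
      fderiv_add h1 h2
    have e1 := hu' x
    have e2 := hv' x
    simp only [divergence] at e1 e2 ⊢
    rw [h]
    simp [Finset.sum_add_distrib, e1, e2]
  zero_mem' := by
    refine ⟨contDiff_const, fun x => ?_⟩
    simp [divergence]
  smul_mem' := by
    rintro c u ⟨hu, hu'⟩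
    refine ⟨contDiff_const.smul hu, fun x => ?_⟩
    have h1 := (hu.differentiable (by simp)) x
    have h : fderiv ℝ (fun x => (c • u) (proj x)) x = c • fderiv ℝ (fun x => u (proj x)) x :=
      fderiv_const_smul h1 c
    have e1 := hu' x
    simp only [divergence] at e1 ⊢
    rw [h]
    simp [← Finset.mul_sum, e1]

/-- The space `SVect(𝕋ᵈ)` of smooth divergence-free vector fields on `𝕋ᵈ`. It is a type of its own
(not reducible to a subtype of a function space) because it carries the `C^∞` topology defined
below, not the topology of pointwise convergence. -/
def SVect (d : ℕ) : Type := ↥(solenoidal d)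

instance (d : ℕ) : AddCommGroup (SVect d) := inferInstanceAs (AddCommGroup ↥(solenoidal d))

instance (d : ℕ) : Module ℝ (SVect d) := inferInstanceAs (Module ℝ ↥(solenoidal d))

/-- The underlying vector field on `𝕋ᵈ`. -/
def SVect.toFun {d : ℕ} (u : SVect d) : Torus d → Space d := Subtype.val u

instance (d : ℕ) : CoeFun (SVect d) (fun _ => Torus d → Space d) := ⟨SVect.toFun⟩

/-- The `2πℤᵈ`-periodic lift to `ℝᵈ` of a field on `𝕋ᵈ`. -/
def SVect.lift {d : ℕ} (u : SVect d) : Space d → Space d := fun x => u (proj x)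

/-- The `C^∞` (Fréchet) topology: uniform convergence of the derivatives of every order. -/
instance (d : ℕ) : TopologicalSpace (SVect d) :=
  TopologicalSpace.induced
    (fun (u : SVect d) (n : ℕ) => UniformFun.ofFun (iteratedFDeriv ℝ n u.lift)) inferInstance

section Smooth

/-- `w` is the directional derivative at `x` in the direction `h` of a map `f` from `ℝᴺ` to a
topological vector space. -/
def HasDirDeriv {N : ℕ} {F : Type} [AddCommGroup F] [Module ℝ F] [TopologicalSpace F]
    (f : Space N → F) (x h : Space N) (w : F) : Prop :=
  Tendsto (fun s : ℝ => s⁻¹ • (f (x + s • h) - f x)) (𝓝[≠] 0) (𝓝 w)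

/-- `f : ℝᴺ → F` is of class `C^k`, where `F` is a topological vector space: `f` is continuous and
all its iterated partial derivatives of order at most `k` exist and are continuous. -/
def IsCk {N : ℕ} {F : Type} [AddCommGroup F] [Module ℝ F] [TopologicalSpace F] :
    ℕ → (Space N → F) → Prop
  | 0, f => Continuous f
  | k + 1, f => Continuous f ∧ ∃ D : Fin N → Space N → F,
      (∀ i x, HasDirDeriv f x (EuclideanSpace.single i 1) (D i x)) ∧ ∀ i, IsCk k (D i)

/-- `U : 𝕋ᴺ → F` is a smooth embedding: it is smooth, its differential is injective at every
point, and it is a homeomorphism onto its image. -/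
structure IsSmoothEmbedding {N : ℕ} {F : Type} [AddCommGroup F] [Module ℝ F]
    [TopologicalSpace F] (U : Torus N → F) : Prop where
  smooth : ∀ k : ℕ, IsCk k (fun x : Space N => U (proj x))
  immersion : ∀ x h : Space N, h ≠ 0 →
    ∃ w : F, w ≠ 0 ∧ HasDirDeriv (fun x : Space N => U (proj x)) x h w
  isEmbedding : IsEmbedding U

end Smooth

/-- `v` is a smooth solution, on the time interval `I`, of the incompressible Euler equations
`∂ₜv + v·∇v + ∇p = 0`, `div v = 0` on `𝕋ᵈ`, for some smooth pressure `p` on `𝕋ᵈ`. The time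
derivative is one-sided at an endpoint of `I`. -/
def IsEulerSolutionOn {d : ℕ} (I : Set ℝ) (v : ℝ → SVect d) : Prop :=
  ContDiffOn ℝ ∞ (fun z : ℝ × Space d => (v z.1).lift z.2) (I ×ˢ Set.univ) ∧
  ∃ p : ℝ → Torus d → ℝ,
    ContDiffOn ℝ ∞ (fun z : ℝ × Space d => p z.1 (proj z.2)) (I ×ˢ Set.univ) ∧
    ∀ t ∈ I, ∀ x : Space d,
      derivWithin (fun s => (v s).lift x) I t
        + fderiv ℝ (v t).lift x ((v t).lift x)
        + gradient (fun y => p t (proj y)) x = 0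

/-- `v` is the solution of the Euler equations with initial datum `u₀`: it is a smooth solution
for all times `t ∈ ℝ`, it equals `u₀` at `t = 0`, and every smooth solution with the same initial
datum, on any interval around or starting or ending at `0`, agrees with it there. -/
structure IsTheEulerSolution {d : ℕ} (u₀ : SVect d) (v : ℝ → SVect d) : Prop where
  initial : v 0 = u₀
  isSolution : IsEulerSolutionOn Set.univ v
  unique : ∀ (I : Set ℝ), I.OrdConnected → 0 ∈ I → ∀ w : ℝ → SVect d,
    IsEulerSolutionOn I w → w 0 = u₀ → ∀ t ∈ I, w t = v t

/-- The field `u` on `𝕋ᵈ` is invariant under the one-parameter group of translations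
`x ↦ x + s a`, `s ∈ ℝ`. -/
def IsInvariantUnderTranslations {d : ℕ} (u : SVect d) (a : Space d) : Prop :=
  ∀ (s : ℝ) (x : Torus d), u (x + proj (s • a)) = u x

/-- No `U θ` is invariant under a (nontrivial) one-parameter group of translations. -/
def IsNonSymmetric {N d : ℕ} (U : Torus N → SVect d) : Prop :=
  ∀ (θ : Torus N) (a : Space d), a ≠ 0 → ¬ IsInvariantUnderTranslations (U θ) a

end EulerTorus

end

/-!
A shear flow `f(x_l) e_a` carries along, without deformation, any flow supported in a strip of
heights `x_l` on which `f` is constant. Into disjoint strips we put circular vortices: steady Euler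
flows, each supported in a small disk times the remaining coordinates. The vortex attached to the
`j`-th coordinate of `𝕋ᴺ` lies in a strip in which `f = ν j`, so its position `θ j` moves with the
speed `ν j`, and the positions parametrize an embedded torus. Where `f = 0` we put one more vortex
in each coordinate plane containing `e_l`: together these break all translation symmetries.
Uniqueness of the solution is the `L²` energy estimate.
-/

noncomputable section

namespace EulerTorus

instance : Fact (0 < 2 * Real.pi) := ⟨Real.two_pi_pos⟩

section Periodic

variable {d : ℕ}

theorem proj_add (x y : Space d) : proj (x + y) = proj x + proj y := by
  ext i; simp [proj]

theorem proj_sub (x y : Space d) : proj (x - y) = proj x - proj y := by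
  ext i; simp [proj]

@[simp] theorem proj_zero : proj (0 : Space d) = 0 := by
  ext; simp [proj]

theorem proj_single (i : Fin d) (s : ℝ) :
    proj (EuclideanSpace.single i s) = Pi.single i (s : AddCircle (2 * Real.pi)) := by
  ext j
  rcases eq_or_ne j i with rfl | h <;> simp [proj, *]

theorem isOpenQuotientMap_proj : IsOpenQuotientMap (proj : Space d → Torus d) := by
  have h : IsOpenQuotientMap (Pi.map fun (_ : Fin d) (x : ℝ) => (x : AddCircle (2 * Real.pi))) :=
    IsOpenQuotientMap.piMap fun _ => QuotientAddGroup.isOpenQuotientMap_mk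
  exact h.comp (EuclideanSpace.equiv (Fin d) ℝ).toHomeomorph.isOpenQuotientMap

/-- The representative in `[-π, π)ᵈ` of a point of the torus. -/
def rep (X : Torus d) : Space d :=
  WithLp.toLp 2 fun i => (AddCircle.equivIco (2 * Real.pi) (-Real.pi) (X i) : ℝ)

theorem coe_rep_apply (X : Torus d) (i : Fin d) : (rep X i : AddCircle (2 * Real.pi)) = X i :=
  (AddCircle.equivIco (2 * Real.pi) (-Real.pi)).symm_apply_apply (X i)

@[simp] theorem proj_rep (X : Torus d) : proj (rep X) = X := funext (coe_rep_apply X)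

theorem abs_rep_apply_le (X : Torus d) (i : Fin d) : |rep X i| ≤ Real.pi := by
  have h := (AddCircle.equivIco (2 * Real.pi) (-Real.pi) (X i)).2
  exact abs_le.2 ⟨h.1, h.2.le.trans_eq (by ring)⟩

theorem abs_rep_apply (X : Torus d) (i : Fin d) : |rep X i| = ‖X i‖ := by
  have h : |rep X i| ≤ |2 * Real.pi| / 2 := by
    rw [abs_of_pos Real.two_pi_pos]
    linarith [abs_rep_apply_le X i]
  rw [← (AddCircle.norm_coe_eq_abs_iff _ Real.two_pi_pos.ne').2 h, coe_rep_apply]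

/-- A function on `ℝᵈ` is `2πℤᵈ`-periodic if it descends to the torus. -/
abbrev IsPeriodic {E : Type*} (g : Space d → E) : Prop :=
  Function.FactorsThrough g (proj : Space d → Torus d)

theorem IsPeriodic.apply_rep_proj {E : Type*} {g : Space d → E} (hg : IsPeriodic g)
    (x : Space d) : g (rep (proj x)) = g x := hg (proj_rep _)

theorem continuousOn_comp_rep {Y E : Type*} [TopologicalSpace Y] [TopologicalSpace E] {s : Set Y}
    {F : Y → Space d → E} (hp : ∀ y ∈ s, IsPeriodic (F y))
    (hF : ContinuousOn (fun z : Y × Space d => F z.1 z.2) (s ×ˢ Set.univ)) :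
    ContinuousOn (fun z : Y × Torus d => F z.1 (rep z.2)) (s ×ˢ Set.univ) := by
  rintro ⟨y, X⟩ ⟨hy, -⟩
  obtain ⟨x, rfl⟩ := isOpenQuotientMap_proj.surjective X
  have h_lift := hF (y, x) ⟨hy, trivial⟩
  rw [ContinuousWithinAt, nhdsWithin_prod_eq, nhdsWithin_univ] at h_lift ⊢
  rw [← isOpenQuotientMap_proj.map_nhds_eq, Filter.prod_map_right, tendsto_map'_iff,
    (hp y hy).apply_rep_proj]
  refine h_lift.congr' ?_
  filter_upwards [prod_mem_prod self_mem_nhdsWithin univ_mem] with z hz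
  exact ((hp z.1 hz.1).apply_rep_proj z.2).symm

theorem IsPeriodic.continuous_comp_rep {E : Type*} [TopologicalSpace E] {g : Space d → E}
    (hg : IsPeriodic g) (hc : Continuous g) : Continuous fun X : Torus d => g (rep X) := by
  rw [isOpenQuotientMap_proj.isQuotientMap.continuous_iff]
  exact hc.congr fun x => (hg.apply_rep_proj x).symm

theorem IsPeriodic.uniformContinuous {E : Type*} [UniformSpace E] {g : Space d → E}
    (hg : IsPeriodic g) (hc : Continuous g) : UniformContinuous g := by
  have h_proj : UniformContinuous (proj : Space d → Torus d) :=
    uniformContinuous_addMonoidHom_of_continuous (f := AddMonoidHom.mk' proj proj_add)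
      isOpenQuotientMap_proj.continuous
  have h_comp : (fun X : Torus d => g (rep X)) ∘ proj = g := funext hg.apply_rep_proj
  exact h_comp ▸ (CompactSpace.uniformContinuous_of_continuous
    (hg.continuous_comp_rep hc)).comp h_proj

variable {E : Type*} [NormedAddCommGroup E] [NormedSpace ℝ E]

theorem IsPeriodic.fderiv {g : Space d → E} (hg : IsPeriodic g) : IsPeriodic (fderiv ℝ g) := by
  intro x y hxy
  have h_shift : (fun z => g (z + (y - x))) = g := by
    ext z
    apply hg
    rw [proj_add, proj_sub, hxy, sub_self, add_zero]
  simpa [h_shift] using fderiv_comp_add_right (𝕜 := ℝ) (f := g) (x := x) (y - x)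

theorem IsPeriodic.iteratedFDeriv {g : Space d → E} (hg : IsPeriodic g) (n : ℕ) :
    IsPeriodic (iteratedFDeriv ℝ n g) := by
  induction n with
  | zero =>
    intro x y h
    ext m
    simp [hg h]
  | succ n ih =>
    intro x y h
    rw [iteratedFDeriv_succ_eq_comp_left, Function.comp_apply, Function.comp_apply, ih.fderiv h]

end Periodic

section DirectionalDerivatives

variable {E F : Type*} [NormedAddCommGroup E] [NormedSpace ℝ E] [NormedAddCommGroup F]
  [NormedSpace ℝ F]

theorem fderiv_fderiv_apply_comm {f : E → F} (hf : ContDiff ℝ 2 f) (x v w : E) :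
    fderiv ℝ (fun y => fderiv ℝ f y v) x w = fderiv ℝ (fun y => fderiv ℝ f y w) x v := by
  have h_diff : DifferentiableAt ℝ (fderiv ℝ f) x :=
    (hf.fderiv_right (m := 1) le_rfl).differentiable one_ne_zero x
  have h_symm : IsSymmSndFDerivAt ℝ f x := hf.contDiffAt.isSymmSndFDerivAt (by simp)
  have h_apply (a b : E) :
      fderiv ℝ (fun y => fderiv ℝ f y a) x b = fderiv ℝ (fderiv ℝ f) x b a := by
    rw [fderiv_clm_apply h_diff (differentiableAt_const a)]
    simp
  rw [h_apply, h_apply, h_symm.eq]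

theorem iteratedFDeriv_fderiv_apply {f : E → F} (hf : ContDiff ℝ ∞ f) (v : E) (n : ℕ) :
    iteratedFDeriv ℝ n (fun y => fderiv ℝ f y v) =
      fun y => fderiv ℝ (iteratedFDeriv ℝ n f) y v := by
  induction n with
  | zero =>
    ext y m
    rw [iteratedFDeriv_zero_apply, iteratedFDeriv_zero_eq_comp,
      (continuousMultilinearCurryFin0 ℝ E F).symm.comp_fderiv]
    simp
  | succ n ih =>
    ext1 y
    have hn : ContDiff ℝ ∞ (iteratedFDeriv ℝ n f) :=
      hf.iteratedFDeriv_right (by exact_mod_cast le_top)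
    have h_diff : DifferentiableAt ℝ (fderiv ℝ (iteratedFDeriv ℝ n f)) y :=
      (hn.fderiv_right (m := ∞) le_rfl).differentiable (by simp) y
    rw [iteratedFDeriv_succ_eq_comp_left, iteratedFDeriv_succ_eq_comp_left, Function.comp_apply,
      ih]
    have h_curry := LinearIsometryEquiv.comp_fderiv (𝕜 := ℝ)
      (continuousMultilinearCurryLeftEquiv ℝ (fun _ : Fin (n + 1) => E) F).symm
      (f := fderiv ℝ (iteratedFDeriv ℝ n f)) (x := y)
    refine Eq.trans ?_ (congrArg (fun L => L v) h_curry).symm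
    refine congrArg (continuousMultilinearCurryLeftEquiv ℝ (fun _ : Fin (n + 1) => E) F).symm ?_
    ext1 w
    rw [fderiv_fderiv_apply_comm (contDiff_infty.1 hn 2),
      fderiv_clm_apply h_diff (differentiableAt_const w)]
    simp

theorem norm_slope_sub_fderiv_le {f : E → F} (hf : Differentiable ℝ f) {a x : E} {C s : ℝ}
    (hs : s ≠ 0)
    (hC : ∀ t : ℝ, ‖t‖ ≤ ‖s‖ → ‖fderiv ℝ f (x + t • a) a - fderiv ℝ f x a‖ ≤ C) :
    ‖s⁻¹ • (f (x + s • a) - f x) - fderiv ℝ f x a‖ ≤ C := by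
  have h_deriv : ∀ t ∈ Metric.closedBall (0 : ℝ) ‖s‖, HasDerivWithinAt
      (fun t : ℝ => f (x + t • a) - t • fderiv ℝ f x a)
      (fderiv ℝ f (x + t • a) a - fderiv ℝ f x a) (Metric.closedBall 0 ‖s‖) t := by
    intro t _
    have h_line : HasDerivAt (fun t : ℝ => x + t • a) a t := by
      simpa using ((hasDerivAt_id t).smul_const a).const_add x
    have h_lin : HasDerivAt (fun t : ℝ => t • fderiv ℝ f x a) (fderiv ℝ f x a) t := by
      simpa using (hasDerivAt_id t).smul_const (fderiv ℝ f x a)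
    exact (((hf _).hasFDerivAt.comp_hasDerivAt t h_line).sub h_lin).hasDerivWithinAt
  have h_mvt := (convex_closedBall (0 : ℝ) ‖s‖).norm_image_sub_le_of_norm_hasDerivWithin_le
    h_deriv (fun t ht => hC t (mem_closedBall_zero_iff.1 ht))
    (Metric.mem_closedBall_self (norm_nonneg s)) (mem_closedBall_zero_iff.2 le_rfl)
  have h_eq : s⁻¹ • (f (x + s • a) - f x) - fderiv ℝ f x a =
      s⁻¹ • (f (x + s • a) - s • fderiv ℝ f x a - f x) := by
    rw [sub_right_comm, smul_sub _ (_ - _) (_ • _), inv_smul_smul₀ hs]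
  rw [h_eq, norm_smul, norm_inv, inv_mul_le_iff₀ (norm_pos_iff.2 hs), mul_comm]
  simpa using h_mvt

theorem tendstoUniformly_slope {f : E → F} (hf : Differentiable ℝ f) {a : E}
    (hu : UniformContinuous fun x => fderiv ℝ f x a) :
    TendstoUniformly (fun (s : ℝ) x => s⁻¹ • (f (x + s • a) - f x)) (fun x => fderiv ℝ f x a)
      (𝓝[≠] 0) := by
  rw [Metric.tendstoUniformly_iff]
  intro ε hε
  obtain ⟨δ, hδ, h_unif⟩ := Metric.uniformContinuous_iff.1 hu (ε / 2) (half_pos hε)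
  have h_small : ∀ᶠ s : ℝ in 𝓝[≠] 0, ‖s‖ * ‖a‖ < δ := by
    have h : Tendsto (fun s : ℝ => ‖s‖ * ‖a‖) (𝓝 0) (𝓝 0) :=
      Continuous.tendsto' (by fun_prop) _ _ (by simp)
    exact nhdsWithin_le_nhds (h.eventually_lt_const hδ)
  filter_upwards [h_small, self_mem_nhdsWithin] with s hs hs0 x
  rw [dist_comm, dist_eq_norm]
  refine (norm_slope_sub_fderiv_le hf hs0 fun t ht => ?_).trans_lt (half_lt_self hε)
  rw [← dist_eq_norm]
  refine (h_unif ?_).le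
  rw [dist_self_add_left, norm_smul]
  exact (mul_le_mul_of_nonneg_right ht (norm_nonneg a)).trans_lt hs

end DirectionalDerivatives

namespace SVect

variable {d : ℕ}

@[ext] theorem ext {u v : SVect d} (h : ∀ X, u X = v X) : u = v := Subtype.ext (funext h)

@[simp] theorem add_apply (u v : SVect d) (X : Torus d) : (u + v) X = u X + v X := rfl

@[simp] theorem sub_apply (u v : SVect d) (X : Torus d) : (u - v) X = u X - v X := rfl

@[simp] theorem zero_apply (X : Torus d) : (0 : SVect d) X = 0 := rfl

@[simp] theorem sum_apply {ι : Type*} (s : Finset ι) (u : ι → SVect d) (X : Torus d) :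
    (∑ i ∈ s, u i) X = ∑ i ∈ s, u i X :=
  map_sum (AddMonoidHom.mk' (fun u : SVect d => u X) fun _ _ => rfl) u s

theorem contDiff_lift (u : SVect d) : ContDiff ℝ ∞ u.lift := u.2.1

theorem differentiable_lift (u : SVect d) : Differentiable ℝ u.lift :=
  u.contDiff_lift.differentiable (by simp)

theorem divergence_lift (u : SVect d) (x : Space d) : divergence u.lift x = 0 := u.2.2 x

theorem isPeriodic_lift (u : SVect d) : IsPeriodic u.lift := fun _ _ h => congrArg u h

theorem lift_injective : Function.Injective (lift : SVect d → Space d → Space d) := by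
  intro u v h
  ext1 X
  simpa [lift] using congrFun h (rep X)

theorem lift_sub (u v : SVect d) : (u - v).lift = u.lift - v.lift := rfl

theorem lift_smul (c : ℝ) (u : SVect d) : (c • u).lift = c • u.lift := rfl

/-- The element of `SVect d` with a given smooth, periodic, divergence-free lift. -/
def ofLift (g : Space d → Space d) (hp : IsPeriodic g) (hs : ContDiff ℝ ∞ g)
    (hd : ∀ x, divergence g x = 0) : SVect d :=
  ⟨fun X => g (rep X), by
    have h : (fun x => g (rep (proj x))) = g := funext hp.apply_rep_proj
    change ContDiff ℝ ∞ (fun x => g (rep (proj x))) ∧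
      ∀ x, divergence (fun x => g (rep (proj x))) x = 0
    rw [h]
    exact ⟨hs, hd⟩⟩

theorem lift_ofLift (g : Space d → Space d) (hp : IsPeriodic g) (hs : ContDiff ℝ ∞ g)
    (hd : ∀ x, divergence g x = 0) : (ofLift g hp hs hd).lift = g := funext hp.apply_rep_proj

theorem tendsto_nhds_iff {ι : Type*} {l : Filter ι} {g : ι → SVect d} {u : SVect d} :
    Tendsto g l (𝓝 u) ↔ ∀ n, TendstoUniformly (fun a => iteratedFDeriv ℝ n (g a).lift)
      (iteratedFDeriv ℝ n u.lift) l := by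
  rw [nhds_induced, tendsto_comap_iff, tendsto_pi_nhds]
  exact forall_congr' fun n => UniformFun.tendsto_iff_tendstoUniformly

theorem contDiff_lift_natCast (u : SVect d) (n : ℕ) : ContDiff ℝ n u.lift :=
  u.contDiff_lift.of_le (by exact_mod_cast le_top)

instance : ContinuousAdd (SVect d) := by
  refine ⟨continuous_iff_continuousAt.2 fun p => tendsto_nhds_iff.2 fun n => ?_⟩
  have h_add (u v : SVect d) : iteratedFDeriv ℝ n (u + v).lift =
      iteratedFDeriv ℝ n u.lift + iteratedFDeriv ℝ n v.lift :=
    iteratedFDeriv_add (u.contDiff_lift_natCast n) (v.contDiff_lift_natCast n)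
  simp only [h_add]
  exact (tendsto_nhds_iff.1 (continuous_fst.tendsto p) n).add
    (tendsto_nhds_iff.1 (continuous_snd.tendsto p) n)

instance : T2Space (SVect d) := by
  refine T2Space.of_injective_continuous (f := fun (u : SVect d) (n : ℕ) =>
    UniformFun.ofFun (iteratedFDeriv ℝ n u.lift)) ?_ continuous_induced_dom
  intro u v h
  apply lift_injective
  ext1 x
  have h_zero := congrFun (congrArg UniformFun.toFun (congrFun h 0)) x
  simpa using congrArg (fun A => A ![]) h_zero

/-- The field `u` transported by the translation `x ↦ x + b` of the torus. -/
def translate (b : Torus d) (u : SVect d) : SVect d :=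
  ⟨fun X => u (X - b), by
    obtain ⟨c, rfl⟩ := isOpenQuotientMap_proj.surjective b
    have h : (fun x => u (proj x - proj c)) = fun x => u.lift (x - c) := by
      ext1 x; simp only [lift, proj_sub]
    change ContDiff ℝ ∞ (fun x => u (proj x - proj c)) ∧
      ∀ x, divergence (fun x => u (proj x - proj c)) x = 0
    rw [h]
    refine ⟨u.contDiff_lift.comp (contDiff_id.sub contDiff_const), fun x => ?_⟩
    rw [divergence, fderiv_comp_sub]
    exact u.divergence_lift _⟩

@[simp] theorem translate_apply (b : Torus d) (u : SVect d) (X : Torus d) :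
    translate b u X = u (X - b) := rfl

theorem lift_translate_proj (b : Space d) (u : SVect d) :
    (translate (proj b) u).lift = fun x => u.lift (x - b) := by
  ext1 x
  simp only [lift, translate_apply, proj_sub]

/-- The directional derivative `∂ₐ u`. -/
def dirDeriv (a : Space d) (u : SVect d) : SVect d :=
  ofLift (fun x => fderiv ℝ u.lift x a) (fun x y h => by simp only [u.isPeriodic_lift.fderiv h])
    ((u.contDiff_lift.fderiv_right (m := ∞) le_rfl).clm_apply contDiff_const) fun x => by
      have h_diff : DifferentiableAt ℝ (fderiv ℝ u.lift) x :=
        (u.contDiff_lift.fderiv_right (m := ∞) le_rfl).differentiable (by simp) x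
      have h_comp (i : Fin d) :
          HasFDerivAt (fun y => fderiv ℝ u.lift y (EuclideanSpace.single i 1) i)
            ((EuclideanSpace.proj i : Space d →L[ℝ] ℝ) ∘L
              fderiv ℝ (fun y => fderiv ℝ u.lift y (EuclideanSpace.single i 1)) x) x :=
        (EuclideanSpace.proj i : Space d →L[ℝ] ℝ).hasFDerivAt.comp x
          (h_diff.clm_apply (differentiableAt_const _)).hasFDerivAt
      have h_div : HasFDerivAt (divergence u.lift) _ x := HasFDerivAt.fun_sum fun i _ => h_comp i
      have h_zero : fderiv ℝ (divergence u.lift) x a = 0 := by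
        rw [funext u.divergence_lift]; simp
      rw [h_div.fderiv] at h_zero
      simpa [divergence, fderiv_fderiv_apply_comm (u.contDiff_lift_natCast 2) x a] using h_zero

theorem lift_dirDeriv (a : Space d) (u : SVect d) :
    (dirDeriv a u).lift = fun x => fderiv ℝ u.lift x a := lift_ofLift _ _ _ _

theorem iteratedFDeriv_lift_translate (b : Space d) (u : SVect d) (n : ℕ) :
    iteratedFDeriv ℝ n (translate (proj b) u).lift =
      fun x => iteratedFDeriv ℝ n u.lift (x - b) := by
  rw [lift_translate_proj]
  exact funext (iteratedFDeriv_comp_sub n b)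

theorem continuous_translate (u : SVect d) : Continuous fun b : Torus d => translate b u := by
  rw [isOpenQuotientMap_proj.isQuotientMap.continuous_iff, continuous_iff_continuousAt]
  refine fun b => tendsto_nhds_iff.2 fun n => ?_
  simp only [Function.comp_apply, iteratedFDeriv_lift_translate]
  have h_unif := (u.isPeriodic_lift.iteratedFDeriv n).uniformContinuous
    (u.contDiff_lift.continuous_iteratedFDeriv (by exact_mod_cast le_top))
  refine h_unif.comp_tendstoUniformly ?_
  rw [Metric.tendstoUniformly_iff]
  intro ε hε
  filter_upwards [Metric.ball_mem_nhds b hε] with c hc x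
  rwa [dist_sub_left, dist_comm]

theorem tendsto_slope_translate (u : SVect d) (b a : Space d) :
    Tendsto (fun s : ℝ => s⁻¹ • (translate (proj (b + s • a)) u - translate (proj b) u)) (𝓝[≠] 0)
      (𝓝 (translate (proj b) (dirDeriv (-a) u))) := by
  refine tendsto_nhds_iff.2 fun n => ?_
  have h_smooth : ContDiff ℝ ∞ (iteratedFDeriv ℝ n u.lift) :=
    u.contDiff_lift.iteratedFDeriv_right (by exact_mod_cast le_top)
  have h_unif : UniformContinuous fun x => fderiv ℝ (iteratedFDeriv ℝ n u.lift) x (-a) :=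
    IsPeriodic.uniformContinuous
      (fun x y h => by simp only [(u.isPeriodic_lift.iteratedFDeriv n).fderiv h])
      ((h_smooth.continuous_fderiv (by simp)).clm_apply continuous_const)
  have h_limit : iteratedFDeriv ℝ n (translate (proj b) (dirDeriv (-a) u)).lift =
      fun x => fderiv ℝ (iteratedFDeriv ℝ n u.lift) (x - b) (-a) := by
    rw [iteratedFDeriv_lift_translate, lift_dirDeriv, iteratedFDeriv_fderiv_apply u.contDiff_lift]
  have h_slope (s : ℝ) : iteratedFDeriv ℝ n
      (s⁻¹ • (translate (proj (b + s • a)) u - translate (proj b) u)).lift = fun x =>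
        s⁻¹ • (iteratedFDeriv ℝ n u.lift (x - b + s • -a) - iteratedFDeriv ℝ n u.lift (x - b)) := by
    ext1 x
    have h_diff (v : SVect d) : ContDiffAt ℝ n v.lift x := (v.contDiff_lift_natCast n).contDiffAt
    rw [lift_smul, iteratedFDeriv_const_smul_apply (h_diff _), lift_sub,
      iteratedFDeriv_sub_apply (h_diff _) (h_diff _), iteratedFDeriv_lift_translate,
      iteratedFDeriv_lift_translate, smul_neg, ← sub_eq_add_neg, sub_sub]
  simp only [h_limit, h_slope]
  exact (tendstoUniformly_slope (h_smooth.differentiable (by simp)) h_unif).comp fun x => x - b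

theorem translate_eq_of_dirDeriv_eq_zero {u : SVect d} {v : Space d}
    (hv : dirDeriv v u = 0) (s : ℝ) : translate (proj (s • v)) u = u := by
  ext1 X
  obtain ⟨x, rfl⟩ := isOpenQuotientMap_proj.surjective X
  have h_line (t : ℝ) : HasDerivAt (fun t : ℝ => u.lift (x - t • v)) 0 t := by
    have h_inner : HasDerivAt (fun t : ℝ => x - t • v) (-v) t := by
      simpa using ((hasDerivAt_id t).smul_const v).const_sub x
    have h_zero : fderiv ℝ u.lift (x - t • v) v = 0 := by
      rw [← congrFun (lift_dirDeriv v u) (x - t • v), hv]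
      rfl
    have h_comp := (u.differentiable_lift _).hasFDerivAt.comp_hasDerivAt t h_inner
    rwa [map_neg, h_zero, neg_zero] at h_comp
  have h_const := is_const_of_deriv_eq_zero (fun t => (h_line t).differentiableAt)
    (fun t => (h_line t).deriv) s 0
  simpa [SVect.lift, proj_sub] using h_const

end SVect

section Integral

open MeasureTheory

variable {d : ℕ}

theorem integrable_of_continuous {F : Torus d → ℝ} (hF : Continuous F) : Integrable F :=
  hF.integrable_of_hasCompactSupport (HasCompactSupport.of_compactSpace F)

theorem apply_eq_zero_of_integral_eq_zero {F : Torus d → ℝ} (hF : Continuous F) (h0 : 0 ≤ F)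
    (h : ∫ X, F X = 0) (X : Torus d) : F X = 0 := by
  have h_ae := (integral_eq_zero_iff_of_nonneg h0 (integrable_of_continuous hF)).1 h
  exact congrFun (Measure.eq_of_ae_eq h_ae hF continuous_const) X

variable {I : Set ℝ} {F : ℝ → Torus d → ℝ}

theorem continuousOn_prod_torus
    (hF : ContinuousOn (fun z : ℝ × Space d => F z.1 (proj z.2)) (I ×ˢ Set.univ)) :
    ContinuousOn (fun z : ℝ × Torus d => F z.1 z.2) (I ×ˢ Set.univ) := by
  simpa only [proj_rep] using
    continuousOn_comp_rep (F := fun t x => F t (proj x)) (fun t _ x y h => congrArg (F t) h) hF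

theorem continuousOn_integral
    (hF : ContinuousOn (fun z : ℝ × Space d => F z.1 (proj z.2)) (I ×ˢ Set.univ)) :
    ContinuousOn (fun t => ∫ X, F t X) I :=
  continuousOn_integral_of_compact_support isCompact_univ (continuousOn_prod_torus hF)
    fun _ _ _ hX => absurd trivial hX

theorem hasDerivAt_time {E : Type*} [NormedAddCommGroup E] [NormedSpace ℝ E] {F : ℝ → Torus d → E}
    (hF : ContDiffOn ℝ ∞ (fun z : ℝ × Space d => F z.1 (proj z.2)) (I ×ˢ Set.univ)) {t : ℝ}
    (ht : t ∈ interior I) (x : Space d) : HasDerivAt (fun s => F s (proj x))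
      (fderiv ℝ (fun z : ℝ × Space d => F z.1 (proj z.2)) (t, x) (1, 0)) t := by
  have h_nhds : I ×ˢ Set.univ ∈ 𝓝 (t, x) :=
    prod_mem_nhds (mem_interior_iff_mem_nhds.1 ht) univ_mem
  exact ((hF.contDiffAt h_nhds).differentiableAt (by simp)).hasFDerivAt.comp_hasDerivAt t
    ((hasDerivAt_id t).prodMk (hasDerivAt_const t x))

theorem continuousOn_deriv_time
    (hF : ContDiffOn ℝ ∞ (fun z : ℝ × Space d => F z.1 (proj z.2)) (I ×ˢ Set.univ)) :
    ContinuousOn (fun z : ℝ × Torus d => deriv (fun s => F s z.2) z.1)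
      (interior I ×ˢ Set.univ) := by
  refine continuousOn_prod_torus (F := fun t X => deriv (fun s => F s X) t) ?_
  have h_fderiv := (hF.mono (Set.prod_mono_left interior_subset)).continuousOn_fderiv_of_isOpen
    (isOpen_interior.prod isOpen_univ) (by simp)
  exact (h_fderiv.clm_apply (continuousOn_const (c := (1, 0)))).congr
    fun z hz => (hasDerivAt_time hF hz.1 z.2).deriv

theorem hasDerivAt_integral
    (hF : ContDiffOn ℝ ∞ (fun z : ℝ × Space d => F z.1 (proj z.2)) (I ×ˢ Set.univ)) {t : ℝ}
    (ht : t ∈ interior I) :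
    HasDerivAt (fun t => ∫ X, F t X) (∫ X, deriv (fun s => F s X) t) t := by
  have h_cont := continuousOn_prod_torus (hF.continuousOn.mono (Set.prod_mono_left interior_subset))
  have h_deriv_cont := continuousOn_deriv_time hF
  have h_slice {G : ℝ × Torus d → ℝ} (hG : ContinuousOn G (interior I ×ˢ Set.univ)) {s : ℝ}
      (hs : s ∈ interior I) : Continuous fun X => G (s, X) :=
    hG.comp_continuous (by fun_prop) fun X => ⟨hs, trivial⟩
  obtain ⟨r, hr, h_ball⟩ := Metric.nhds_basis_closedBall.mem_iff.1 (isOpen_interior.mem_nhds ht)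
  obtain ⟨C, hC⟩ := ((isCompact_closedBall t r).prod
    (isCompact_univ (X := Torus d))).exists_bound_of_continuousOn
    (h_deriv_cont.mono (Set.prod_mono_left h_ball))
  refine (hasDerivAt_integral_of_dominated_loc_of_deriv_le (bound := fun _ => C)
    (Metric.closedBall_mem_nhds t hr) ?_ (integrable_of_continuous (h_slice h_cont ht))
    (h_slice h_deriv_cont ht).aestronglyMeasurable
    (Eventually.of_forall fun X s hs => hC (s, X) ⟨hs, trivial⟩) (integrable_const C)
    (Eventually.of_forall fun X s hs => ?_)).2
  · filter_upwards [isOpen_interior.mem_nhds ht] with s hs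
    exact (h_slice h_cont hs).aestronglyMeasurable
  · obtain ⟨x, rfl⟩ := isOpenQuotientMap_proj.surjective X
    exact (hasDerivAt_time hF (h_ball hs) x).differentiableAt.hasDerivAt

theorem integral_fderiv_eq_zero {g : Torus d → ℝ} (hg : ContDiff ℝ ∞ fun x => g (proj x))
    (a : Space d) : ∫ X, fderiv ℝ (fun x => g (proj x)) (rep X) a = 0 := by
  have h_smooth : ContDiff ℝ ∞ fun z : ℝ × Space d => g (proj z.2 + proj (z.1 • a)) := by
    simp only [← proj_add]
    exact hg.comp (contDiff_snd.add (contDiff_fst.smul contDiff_const))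
  have h_deriv := hasDerivAt_integral (I := Set.univ) (F := fun s X => g (X + proj (s • a)))
    h_smooth.contDiffOn (t := 0) (by simp)
  -- The integral does not depend on the shift, so its derivative vanishes.
  simp only [integral_add_right_eq_self g] at h_deriv
  rw [← h_deriv.unique (hasDerivAt_const _ _)]
  congr 1
  ext1 X
  have h_line := ((hg.differentiable (by simp) (rep X)).hasFDerivAt.hasLineDerivAt a).deriv
  simpa only [proj_add, proj_rep] using h_line.symm

theorem integral_divergence_eq_zero {V : Torus d → Space d}
    (hV : ContDiff ℝ ∞ fun x => V (proj x)) :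
    ∫ X, divergence (fun x => V (proj x)) (rep X) = 0 := by
  have h_comp (i : Fin d) : ContDiff ℝ ∞ fun x => V (proj x) i :=
    (EuclideanSpace.proj i : Space d →L[ℝ] ℝ).contDiff.comp hV
  have h_div (x : Space d) : divergence (fun x => V (proj x)) x =
      ∑ i, fderiv ℝ (fun x => V (proj x) i) x (EuclideanSpace.single i 1) := by
    refine Finset.sum_congr rfl fun i _ => ?_
    have h := (EuclideanSpace.proj i : Space d →L[ℝ] ℝ).hasFDerivAt.comp x
      (hV.differentiable (by simp) x).hasFDerivAt
    exact (congrArg (fun L => L (EuclideanSpace.single i 1)) h.fderiv).symm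
  simp only [h_div]
  rw [integral_finsetSum]
  · exact Finset.sum_eq_zero fun i _ => integral_fderiv_eq_zero (g := fun X => V X i) (h_comp i) _
  · intro i _
    have h_per : IsPeriodic fun x => V (proj x) i := fun x y h => by simp only [h]
    exact integrable_of_continuous <| IsPeriodic.continuous_comp_rep
      (fun x y h => by simp only [h_per.fderiv h])
      (((h_comp i).continuous_fderiv (by simp)).clm_apply continuous_const)

theorem divergence_smul {φ : Space d → ℝ} {u : Space d → Space d} {x : Space d}
    (hφ : DifferentiableAt ℝ φ x) (hu : DifferentiableAt ℝ u x) :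
    divergence (fun y => φ y • u y) x = fderiv ℝ φ x (u x) + φ x * divergence u x := by
  have h : fderiv ℝ φ x (u x) = ∑ i, u x i * fderiv ℝ φ x (EuclideanSpace.single i 1) := by
    conv_lhs => rw [← (EuclideanSpace.basisFun (Fin d) ℝ).sum_repr (u x)]
    simp
  rw [divergence, (hφ.hasFDerivAt.fun_smul hu.hasFDerivAt).fderiv, h, divergence, Finset.mul_sum,
    ← Finset.sum_add_distrib]
  refine Finset.sum_congr rfl fun i _ => ?_
  simp only [add_apply, smul_apply, ContinuousLinearMap.smulRight_apply, PiLp.add_apply,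
    PiLp.smul_apply, smul_eq_mul]
  ring

theorem integral_fderiv_apply_eq_zero {g : Torus d → ℝ} (hg : ContDiff ℝ ∞ fun x => g (proj x))
    (w : SVect d) : ∫ X, fderiv ℝ (fun x => g (proj x)) (rep X) (w X) = 0 := by
  rw [← integral_divergence_eq_zero (V := fun X => g X • w X) (hg.smul w.contDiff_lift)]
  congr 1
  ext1 X
  have h := divergence_smul (hg.differentiable (by simp) (rep X)) (w.differentiable_lift (rep X))
  rw [w.divergence_lift, mul_zero, add_zero] at h
  simpa [SVect.lift] using h.symm

end Integral

section Gronwall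

theorem antitoneOn_exp_neg_mul {E E' : ℝ → ℝ} {M : ℝ} {J : Set ℝ} (hJ : Convex ℝ J)
    (hc : ContinuousOn E J) (hd : ∀ t ∈ interior J, HasDerivAt E (E' t) t)
    (hb : ∀ t ∈ interior J, E' t ≤ M * E t) :
    AntitoneOn (fun t => Real.exp (-M * t) * E t) J := by
  have h_deriv : ∀ t ∈ interior J, HasDerivAt (fun t => Real.exp (-M * t) * E t)
      (Real.exp (-M * t) * (E' t - M * E t)) t := by
    intro t ht
    have h_exp : HasDerivAt (fun t => Real.exp (-M * t)) (Real.exp (-M * t) * -M) t := by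
      simpa using ((hasDerivAt_id t).const_mul (-M)).exp
    exact (h_exp.mul (hd t ht)).congr_deriv (by ring)
  refine antitoneOn_of_deriv_nonpos hJ ((Continuous.continuousOn (by fun_prop)).mul hc)
    (fun t ht => (h_deriv t ht).differentiableAt.differentiableWithinAt) fun t ht => ?_
  rw [(h_deriv t ht).deriv]
  exact mul_nonpos_of_nonneg_of_nonpos (Real.exp_pos _).le (sub_nonpos.2 (hb t ht))

theorem nonpos_of_abs_deriv_le {E E' : ℝ → ℝ} {M T : ℝ} (hc : ContinuousOn E (Set.uIcc 0 T))
    (hd : ∀ t ∈ interior (Set.uIcc 0 T), HasDerivAt E (E' t) t)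
    (hb : ∀ t ∈ interior (Set.uIcc 0 T), |E' t| ≤ M * E t) (h0 : E 0 = 0) :
    E T ≤ 0 := by
  rcases le_total 0 T with hT | hT
  · have h := antitoneOn_exp_neg_mul (convex_uIcc 0 T) hc hd (fun t ht => le_of_abs_le (hb t ht))
      Set.left_mem_uIcc Set.right_mem_uIcc hT
    simp only [h0, mul_zero] at h
    exact nonpos_of_mul_nonpos_right h (Real.exp_pos _)
  · have h := antitoneOn_exp_neg_mul (M := -M) (convex_uIcc 0 T) hc.fun_neg
      (fun t ht => (hd t ht).fun_neg)
      (fun t ht => by rw [neg_mul_neg]; exact (neg_le_abs _).trans (hb t ht))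
      Set.right_mem_uIcc Set.left_mem_uIcc hT
    simp only [h0, neg_zero, mul_zero, mul_neg, neg_nonneg] at h
    exact nonpos_of_mul_nonpos_right h (Real.exp_pos _)

end Gronwall

section Uniqueness

open MeasureTheory
open scoped RealInnerProductSpace

variable {d : ℕ} {I : Set ℝ} {v w : ℝ → SVect d}

theorem IsEulerSolutionOn.exists_hasDerivAt (hv : IsEulerSolutionOn I v) {t : ℝ}
    (ht : t ∈ interior I) :
    ∃ q : Torus d → ℝ, ContDiff ℝ ∞ (fun x => q (proj x)) ∧
      ∀ x : Space d, HasDerivAt (fun s => (v s).lift x)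
        (-fderiv ℝ (v t).lift x ((v t).lift x) - gradient (fun y => q (proj y)) x) t := by
  obtain ⟨hvs, p, hps, hpe⟩ := hv
  have h_slice : ContDiffOn ℝ ∞ (fun x : Space d => (t, x)) Set.univ :=
    (contDiff_const.prodMk contDiff_id).contDiffOn
  refine ⟨p t, contDiffOn_univ.1 (hps.comp h_slice fun y _ => ⟨interior_subset ht, trivial⟩),
    fun x => ?_⟩
  have h_eq := hpe t (interior_subset ht) x
  rw [derivWithin_of_mem_nhds (mem_interior_iff_mem_nhds.1 ht), add_assoc] at h_eq
  rw [← neg_add', ← eq_neg_of_add_eq_zero_left h_eq]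
  exact (hasDerivAt_time (F := fun s X => v s X) hvs ht x).differentiableAt.hasDerivAt

/-- The first two terms on the right are divergences. -/
theorem two_mul_inner_sub_eq (v w : SVect d) (x b : Space d) :
    2 * ⟪(w - v).lift x, -(fderiv ℝ w.lift x (w.lift x) - fderiv ℝ v.lift x (v.lift x)) - b⟫ =
      -fderiv ℝ (fun y => ‖(w - v).lift y‖ ^ 2) x (w.lift x) - 2 * ⟪b, (w - v).lift x⟫
        - 2 * ⟪(w - v).lift x, fderiv ℝ v.lift x ((w - v).lift x)⟫ := by
  have h_norm : fderiv ℝ (fun y => ‖(w - v).lift y‖ ^ 2) x (w.lift x) =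
      2 * ⟪(w - v).lift x, fderiv ℝ (w - v).lift x (w.lift x)⟫ := by
    rw [((w - v).differentiable_lift x).hasFDerivAt.norm_sq.fderiv]
    simp
  have h_sub : fderiv ℝ (w - v).lift x = fderiv ℝ w.lift x - fderiv ℝ v.lift x :=
    fderiv_sub (w.differentiable_lift x) (v.differentiable_lift x)
  rw [h_norm, h_sub, SVect.lift_sub, Pi.sub_apply, real_inner_comm _ b]
  simp only [_root_.sub_apply, map_sub, inner_sub_right, inner_neg_right]
  ring

theorem contDiffOn_norm_sq_sub (hv : IsEulerSolutionOn Set.univ v) (hw : IsEulerSolutionOn I w) :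
    ContDiffOn ℝ ∞ (fun z : ℝ × Space d => ‖(w z.1 - v z.1) (proj z.2)‖ ^ 2) (I ×ˢ Set.univ) :=
  (hw.1.sub (hv.1.mono (Set.prod_mono_left (Set.subset_univ I)))).norm_sq ℝ

theorem SVect.continuous_coe (u : SVect d) : Continuous fun X => u X := by
  rw [isOpenQuotientMap_proj.isQuotientMap.continuous_iff]
  exact u.contDiff_lift.continuous

theorem continuous_fderiv_apply {E : Type*} [NormedAddCommGroup E] [NormedSpace ℝ E]
    {g : Torus d → E} (hg : ContDiff ℝ ∞ fun x => g (proj x)) (u : SVect d) :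
    Continuous fun X => fderiv ℝ (fun x => g (proj x)) (rep X) (u X) := by
  have h_per : IsPeriodic fun x => g (proj x) := fun x y h => congrArg g h
  exact (h_per.fderiv.continuous_comp_rep (hg.continuous_fderiv (by simp))).clm_apply
    u.continuous_coe

theorem integral_divergence_terms (v w : SVect d) {q : Torus d → ℝ}
    (hq : ContDiff ℝ ∞ fun x => q (proj x)) {G : Torus d → ℝ} (hG : Continuous G) :
    ∫ X, (-fderiv ℝ (fun x => ‖v (proj x)‖ ^ 2) (rep X) (w X)
      - 2 * fderiv ℝ (fun x => q (proj x)) (rep X) (v X) - G X) = -∫ X, G X := by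
  have h_sq : ContDiff ℝ ∞ fun x => ‖v (proj x)‖ ^ 2 := v.contDiff_lift.norm_sq ℝ
  have h_int_sq :=
    integrable_of_continuous (continuous_fderiv_apply (g := fun X => ‖v X‖ ^ 2) h_sq w)
  have h_int_q := (integrable_of_continuous (continuous_fderiv_apply hq v)).const_mul 2
  rw [integral_sub (Integrable.sub' h_int_sq.fun_neg h_int_q) (integrable_of_continuous hG),
    integral_sub h_int_sq.fun_neg h_int_q, integral_neg, integral_const_mul,
    integral_fderiv_apply_eq_zero (g := fun X => ‖v X‖ ^ 2) h_sq,
    integral_fderiv_apply_eq_zero hq]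
  simp

theorem hasDerivAt_energy (hv : IsEulerSolutionOn Set.univ v) (hw : IsEulerSolutionOn I w) {t : ℝ}
    (ht : t ∈ interior I) :
    HasDerivAt (fun s => ∫ X, ‖(w s - v s) X‖ ^ 2)
      (-∫ X, 2 * ⟪(w t - v t) X, fderiv ℝ (v t).lift (rep X) ((w t - v t) X)⟫) t := by
  refine (hasDerivAt_integral (contDiffOn_norm_sq_sub hv hw) ht).congr_deriv ?_
  obtain ⟨p, hp, hvt⟩ := hv.exists_hasDerivAt (t := t) (by simp)
  obtain ⟨q, hq, hwt⟩ := hw.exists_hasDerivAt ht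
  have h_diff := hq.sub hp
  have h_cont : Continuous fun X =>
      2 * ⟪(w t - v t) X, fderiv ℝ (v t).lift (rep X) ((w t - v t) X)⟫ :=
    continuous_const.mul ((w t - v t).continuous_coe.inner
      (continuous_fderiv_apply (v t).contDiff_lift (w t - v t)))
  rw [← integral_divergence_terms (w t - v t) (w t) (q := fun X => q X - p X) h_diff h_cont]
  congr 1
  ext1 X
  have h_grad : gradient (fun y => q (proj y) - p (proj y)) (rep X) =
      gradient (fun y => q (proj y)) (rep X) - gradient (fun y => p (proj y)) (rep X) := by
    rw [gradient, fderiv_fun_sub (hq.differentiable (by simp) _) (hp.differentiable (by simp) _),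
      map_sub]
    rfl
  have h_deriv := ((hwt (rep X)).fun_sub (hvt (rep X))).norm_sq.deriv
  have h_balance := two_mul_inner_sub_eq (v t) (w t) (rep X)
    (gradient (fun y => q (proj y) - p (proj y)) (rep X))
  rw [inner_gradient_left] at h_balance
  simp only [SVect.lift, proj_rep] at h_deriv h_balance
  rw [← h_balance, h_grad]
  exact h_deriv.trans (congrArg (fun z => 2 * ⟪(w t - v t) X, z⟫) (by abel))

theorem exists_norm_fderiv_lift_le (hv : IsEulerSolutionOn Set.univ v) {J : Set ℝ}
    (hJ : IsCompact J) : ∃ M, ∀ t ∈ J, ∀ X, ‖fderiv ℝ (v t).lift (rep X)‖ ≤ M := by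
  have h_smooth : ContDiff ℝ ∞ fun z : ℝ × Space d => (v z.1).lift z.2 := by
    simpa [contDiffOn_univ] using hv.1
  have h_fderiv : Continuous fun z : ℝ × Space d => fderiv ℝ (v z.1).lift z.2 :=
    (ContDiff.fderiv (n := 0) (m := ∞) (f := fun (z : ℝ × Space d) y => (v z.1).lift y)
      (h_smooth.comp ((contDiff_fst.comp contDiff_fst).prodMk contDiff_snd)) contDiff_snd
      (by simp)).continuous
  obtain ⟨M, hM⟩ := (hJ.prod (isCompact_univ (X := Torus d))).exists_bound_of_continuousOn
    (continuousOn_comp_rep (F := fun t x => fderiv ℝ (v t).lift x)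
      (fun t _ => (v t).isPeriodic_lift.fderiv) h_fderiv.continuousOn)
  exact ⟨M, fun t ht X => hM (t, X) ⟨ht, trivial⟩⟩

theorem abs_integral_two_mul_inner_le (u : SVect d) {A : Torus d → Space d →L[ℝ] Space d} {M : ℝ}
    (hA : ∀ X, ‖A X‖ ≤ M) :
    |-∫ X, 2 * ⟪u X, A X (u X)⟫| ≤ 2 * M * ∫ X, ‖u X‖ ^ 2 := by
  rw [abs_neg, ← integral_const_mul, ← Real.norm_eq_abs]
  refine norm_integral_le_of_norm_le (integrable_of_continuous
    (continuous_const.mul (u.continuous_coe.norm.pow 2))) (Eventually.of_forall fun X => ?_)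
  have h_op : ‖A X (u X)‖ ≤ M * ‖u X‖ := (A X).le_of_opNorm_le (hA X) (u X)
  calc ‖2 * ⟪u X, A X (u X)⟫‖ ≤ 2 * (‖u X‖ * ‖A X (u X)‖) := by
        rw [norm_mul, Real.norm_two]
        gcongr
        exact norm_inner_le_norm _ _
    _ ≤ 2 * (‖u X‖ * (M * ‖u X‖)) := by gcongr
    _ = 2 * M * ‖u X‖ ^ 2 := by ring

theorem IsEulerSolutionOn.eq_of_initial_eq (hv : IsEulerSolutionOn Set.univ v)
    (hw : IsEulerSolutionOn I w) (hI : I.OrdConnected) (h0 : 0 ∈ I) (hvw : w 0 = v 0) {T : ℝ}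
    (hT : T ∈ I) : w T = v T := by
  have h_sub : Set.uIcc 0 T ⊆ I := hI.uIcc_subset h0 hT
  obtain ⟨M, hM⟩ := exists_norm_fderiv_lift_le hv (isCompact_uIcc (a := 0) (b := T))
  have h_nonpos : ∫ X, ‖(w T - v T) X‖ ^ 2 ≤ 0 := nonpos_of_abs_deriv_le
    ((continuousOn_integral (contDiffOn_norm_sq_sub hv hw).continuousOn).mono h_sub)
    (fun t ht => hasDerivAt_energy hv hw (interior_mono h_sub ht))
    (fun t ht => abs_integral_two_mul_inner_le _ (hM t (interior_subset ht)))
    (by simp [hvw])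
  have h_zero := apply_eq_zero_of_integral_eq_zero ((w T - v T).continuous_coe.norm.pow 2)
    (fun X => sq_nonneg _) (h_nonpos.antisymm (integral_nonneg fun X => sq_nonneg _))
  ext1 X
  simpa [sub_eq_zero] using h_zero X

end Uniqueness

theorem isTheEulerSolution_of_isEulerSolutionOn {d : ℕ} {v : ℝ → SVect d}
    (hv : IsEulerSolutionOn Set.univ v) : IsTheEulerSolution (v 0) v :=
  ⟨rfl, hv, fun _ hI h0 _ hw hw0 _ ht => hv.eq_of_initial_eq hw hI h0 hw0 ht⟩

section Superposition

variable {d N : ℕ} {ι : Type*} [Fintype ι]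

/-- The field `C` together with copies of the fields `V i`, the `i`-th one moved to the position
`b i`. -/
def superposition (C : SVect d) (V : ι → SVect d) (b : ι → Torus d) : SVect d :=
  C + ∑ i, SVect.translate (b i) (V i)

theorem superposition_apply (C : SVect d) (V : ι → SVect d) (b : ι → Torus d) (X : Torus d) :
    superposition C V b X = C X + ∑ i, V i (X - b i) := by
  simp [superposition]

theorem lift_superposition (C : SVect d) (V : ι → SVect d) (b : ι → Space d) (x : Space d) :
    (superposition C V fun i => proj (b i)).lift x = C.lift x + ∑ i, (V i).lift (x - b i) := by
  simp only [SVect.lift, superposition_apply, proj_sub]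

theorem continuous_superposition (C : SVect d) (V : ι → SVect d) :
    Continuous (superposition C V) :=
  continuous_const.add (continuous_finsetSum _ fun i _ =>
    (SVect.continuous_translate (V i)).comp (continuous_apply i))

variable (C : SVect d) (V : ι → SVect d) (b : ι → Space d) (L : ι → Space N →L[ℝ] Space d)

theorem hasDirDeriv_superposition (x h : Space N) :
    HasDirDeriv (fun x => superposition C V fun i => proj (b i + L i x)) x h
      (superposition 0 (fun i => SVect.dirDeriv (-L i h) (V i)) fun i => proj (b i + L i x)) := by
  have h_slope := tendsto_finsetSum (Finset.univ : Finset ι) fun i _ =>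
    SVect.tendsto_slope_translate (V i) (b i + L i x) (L i h)
  unfold HasDirDeriv superposition
  rw [zero_add]
  refine h_slope.congr fun s => ?_
  rw [← Finset.smul_sum, add_sub_add_left_eq_sub, Finset.sum_sub_distrib]
  simp only [map_add, map_smul, add_assoc]

theorem isCk_superposition (k : ℕ) :
    IsCk k fun x => superposition C V fun i => proj (b i + L i x) := by
  have h_cont (C : SVect d) (V : ι → SVect d) :
      Continuous fun x => superposition C V fun i => proj (b i + L i x) :=
    (continuous_superposition C V).comp <| continuous_pi fun i =>
      isOpenQuotientMap_proj.continuous.comp (continuous_const.add (L i).continuous)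
  induction k generalizing C V with
  | zero => exact h_cont C V
  | succ k ih =>
    exact ⟨h_cont C V, _, fun i x => hasDirDeriv_superposition C V b L x _, fun i => ih _ _⟩

end Superposition

section Advection

variable {ι : Type*} [Fintype ι]

section

variable {E F : Type*} [NormedAddCommGroup E] [NormedSpace ℝ E] [NormedAddCommGroup F]
  [NormedSpace ℝ F]

theorem fderiv_eq_zero_of_ne_zero {f : E → F} {g : E → E} {c : F} (hg : Continuous g)
    (h : ∀ x, g x ≠ 0 → f x = c) {x : E} (hx : g x ≠ 0) : fderiv ℝ f x = 0 := by
  have h_const : f =ᶠ[𝓝 x] fun _ => c := (hg.continuousAt.eventually_ne hx).mono h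
  rw [h_const.fderiv_eq, fderiv_fun_const, Pi.zero_apply]

theorem fderiv_apply_eq_of_ne_zero {f : E → F} {g : E → E} {c : E} (hg : Continuous g)
    (h : ∀ x, f x ≠ 0 → g x = c) (x : E) : fderiv ℝ f x (g x) = fderiv ℝ f x c := by
  by_cases hx : x ∈ tsupport f
  · rw [closure_minimal h (isClosed_eq hg continuous_const) hx]
  · rw [(notMem_tsupport_iff_eventuallyEq.1 hx).fderiv_eq]
    simp

theorem fderiv_add_sum_apply {S : E → E} {W : ι → E → E} {v : ι → E} (hS : Differentiable ℝ S)
    (hW : ∀ i, Differentiable ℝ (W i)) (hconst : ∀ i x, W i x ≠ 0 → S x = v i)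
    (hdisj : ∀ i j x, W i x ≠ 0 → W j x ≠ 0 → i = j) (x : E) :
    fderiv ℝ (fun y => S y + ∑ i, W i y) x (S x + ∑ i, W i x) =
      fderiv ℝ S x (S x) + ∑ i, (fderiv ℝ (W i) x (W i x) + fderiv ℝ (W i) x (v i)) := by
  have h_SW (i : ι) : fderiv ℝ S x (W i x) = 0 := by
    by_cases hx : W i x = 0
    · rw [hx, map_zero]
    · rw [fderiv_eq_zero_of_ne_zero (hW i).continuous (hconst i) hx, zero_apply]
  have h_WS (i : ι) : fderiv ℝ (W i) x (S x) = fderiv ℝ (W i) x (v i) :=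
    fderiv_apply_eq_of_ne_zero hS.continuous (hconst i) x
  have h_WW (i j : ι) (hji : j ≠ i) : fderiv ℝ (W i) x (W j x) = 0 := by
    rw [fderiv_apply_eq_of_ne_zero (hW j).continuous (c := 0), map_zero]
    exact fun y hi => by_contra fun hj => hji (hdisj j i y hj hi)
  rw [fderiv_fun_add (hS x) (DifferentiableAt.fun_sum fun i _ => hW i x),
    fderiv_fun_sum fun i _ => hW i x]
  have h_sum (j : ι) : ∑ i, fderiv ℝ (W i) x (W j x) = fderiv ℝ (W j) x (W j x) :=
    Finset.sum_eq_single j (fun i _ hij => h_WW i j hij.symm) (by simp)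
  simp only [add_apply, sum_apply, map_add, map_sum, h_SW, h_WS, h_sum, zero_add,
    Finset.sum_add_distrib]
  abel

end

variable {d : ℕ}

theorem gradient_sum_comp_sub {q : ι → Space d → ℝ} (hq : ∀ i, Differentiable ℝ (q i))
    (b : ι → Space d) (x : Space d) :
    gradient (fun y => ∑ i, q i (y - b i)) x = ∑ i, gradient (q i) (x - b i) := by
  have h_diff (i : ι) : DifferentiableAt ℝ (fun y => q i (y - b i)) x :=
    (hq i _).comp x (differentiableAt_id.sub_const (b i))
  simp only [gradient, fderiv_fun_sum fun i _ => h_diff i, map_sum, fderiv_comp_sub]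

theorem isEulerSolutionOn_superposition {S : SVect d} {W : ι → SVect d} {q : ι → Torus d → ℝ}
    {b v : ι → Space d} (hS : ∀ x, fderiv ℝ S.lift x (S.lift x) = 0)
    (hq : ∀ i, ContDiff ℝ ∞ fun x => q i (proj x))
    (hW : ∀ i x, fderiv ℝ (W i).lift x ((W i).lift x) + gradient (fun y => q i (proj y)) x = 0)
    (hconst : ∀ i (t : ℝ) X, W i (X - proj (b i + t • v i)) ≠ 0 → S X = v i)
    (hdisj : ∀ i j (t : ℝ) X, W i (X - proj (b i + t • v i)) ≠ 0 →
      W j (X - proj (b j + t • v j)) ≠ 0 → i = j) :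
    IsEulerSolutionOn Set.univ fun t => superposition S W fun i => proj (b i + t • v i) := by
  have h_shift (i : ι) : ContDiff ℝ ∞ fun z : ℝ × Space d => z.2 - (b i + z.1 • v i) :=
    contDiff_snd.sub (contDiff_const.add (contDiff_fst.smul contDiff_const))
  refine ⟨ContDiff.contDiffOn ?_, fun t X => ∑ i, q i (X - proj (b i + t • v i)),
    ContDiff.contDiffOn ?_, fun t _ x => ?_⟩
  · simp only [lift_superposition]
    exact (S.contDiff_lift.comp contDiff_snd).add
      (ContDiff.sum fun i _ => (W i).contDiff_lift.comp (h_shift i))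
  · simp only [← proj_sub]
    exact ContDiff.sum fun i _ => (hq i).comp (h_shift i)
  · have h_time : HasDerivAt (fun s => S.lift x + ∑ i, (W i).lift (x - (b i + s • v i)))
        (∑ i, fderiv ℝ (W i).lift (x - (b i + t • v i)) (-v i)) t := by
      refine (HasDerivAt.fun_sum fun i _ => ?_).const_add _
      have h_line : HasDerivAt (fun s : ℝ => x - (b i + s • v i)) (-v i) t := by
        simpa using (((hasDerivAt_id t).smul_const (v i)).const_add (b i)).const_sub x
      exact ((W i).differentiable_lift _).hasFDerivAt.comp_hasDerivAt t h_line
    have h_space := fderiv_add_sum_apply (W := fun i y => (W i).lift (y - (b i + t • v i)))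
      (v := v) S.differentiable_lift
      (fun i => (W i).differentiable_lift.comp (differentiable_id.sub_const _))
      (fun i y hy => hconst i t (proj y) (by rwa [← proj_sub]))
      (fun i j y hi hj => hdisj i j t (proj y) (by rwa [← proj_sub]) (by rwa [← proj_sub])) x
    have h_pressure := gradient_sum_comp_sub (q := fun i y => q i (proj y))
      (fun i => (hq i).differentiable (by simp)) (fun i => b i + t • v i) x
    simp only [derivWithin_univ, ← proj_sub, funext (lift_superposition S W _), lift_superposition,
      h_time.deriv, h_space, h_pressure, hS, fderiv_comp_sub, map_neg, zero_add,
      ← Finset.sum_add_distrib]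
    refine Finset.sum_eq_zero fun i _ => ?_
    rw [← hW i (x - (b i + t • v i))]
    abel

end Advection

section Periodization

variable {d : ℕ} {E : Type*} {s : Set (Fin d)} {r : ℝ} {g : Space d → E}

theorem rep_proj_apply_of_abs_lt {x : Space d} {i : Fin d} (hx : |x i| < Real.pi) :
    rep (proj x) i = x i := by
  rw [abs_lt] at hx
  exact AddCircle.equivIco_coe_of_mem ⟨hx.1.le, by linarith⟩

theorem eventuallyEq_comp_rep_proj [Zero E] (hr : r < Real.pi)
    (hdep : ∀ x y, (∀ i ∈ s, x i = y i) → g x = g y)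
    (hsupp : ∀ x, ∀ i ∈ s, r ≤ |x i| → g x = 0) (x₀ : Space d) :
    (fun x => g (rep (proj x))) =ᶠ[𝓝 x₀] fun x => g (x - (x₀ - rep (proj x₀))) := by
  have h_cont (i : Fin d) : Continuous fun x : Space d => |(x - (x₀ - rep (proj x₀))) i| := by
    fun_prop
  have h_base : x₀ - (x₀ - rep (proj x₀)) = rep (proj x₀) := sub_sub_cancel _ _
  by_cases h : ∀ i ∈ s, |rep (proj x₀) i| < Real.pi
  · have h_near : ∀ i ∈ s, ∀ᶠ x in 𝓝 x₀, |(x - (x₀ - rep (proj x₀))) i| < Real.pi := fun i hi =>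
      (h_cont i).continuousAt.eventually_lt_const (by simpa only [h_base] using h i hi)
    filter_upwards [(Set.toFinite s).eventually_all.2 h_near] with x hx
    refine hdep _ _ fun i hi => ?_
    rw [← rep_proj_apply_of_abs_lt (hx i hi), proj_sub, proj_sub, proj_rep, sub_self, sub_zero]
  · push Not at h
    obtain ⟨i, hi, hπ⟩ := h
    have h_far : ∀ᶠ x in 𝓝 x₀, r < |(x - (x₀ - rep (proj x₀))) i| :=
      (h_cont i).continuousAt.eventually_const_lt (by simpa only [h_base] using hr.trans_le hπ)
    have h_rep : ∀ᶠ x in 𝓝 x₀, r < ‖proj x i‖ := by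
      have h_norm : Continuous fun x : Space d => ‖proj x i‖ :=
        ((continuous_apply i).comp isOpenQuotientMap_proj.continuous).norm
      exact h_norm.continuousAt.eventually_const_lt
        (by simpa only [← abs_rep_apply] using hr.trans_le hπ)
    filter_upwards [h_far, h_rep] with x hx hx'
    rw [hsupp _ i hi hx.le, hsupp _ i hi (by rw [abs_rep_apply]; exact hx'.le)]

variable [NormedAddCommGroup E] [NormedSpace ℝ E]

theorem contDiff_comp_rep_proj (hr : r < Real.pi)
    (hdep : ∀ x y, (∀ i ∈ s, x i = y i) → g x = g y)
    (hsupp : ∀ x, ∀ i ∈ s, r ≤ |x i| → g x = 0) (hg : ContDiff ℝ ∞ g) :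
    ContDiff ℝ ∞ fun x => g (rep (proj x)) :=
  contDiff_iff_contDiffAt.2 fun x =>
    (hg.comp (contDiff_id.sub contDiff_const)).contDiffAt.congr_of_eventuallyEq
      (eventuallyEq_comp_rep_proj hr hdep hsupp x)

theorem fderiv_comp_rep_proj (hr : r < Real.pi)
    (hdep : ∀ x y, (∀ i ∈ s, x i = y i) → g x = g y)
    (hsupp : ∀ x, ∀ i ∈ s, r ≤ |x i| → g x = 0) (x : Space d) :
    fderiv ℝ (fun x => g (rep (proj x))) x = fderiv ℝ g (rep (proj x)) := by
  rw [(eventuallyEq_comp_rep_proj hr hdep hsupp x).fderiv_eq, fderiv_comp_sub, sub_sub_cancel]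

end Periodization

section CircularFlow

variable {d : ℕ}

/-- The angular velocity of a circular flow in the disk of radius `|ε|`, as a function of the
squared distance `s` to the centre. -/
def angularVelocity (ε s : ℝ) : ℝ := expNegInvGlue (ε ^ 2 - s)

theorem contDiff_angularVelocity (ε : ℝ) : ContDiff ℝ ∞ (angularVelocity ε) :=
  (expNegInvGlue.contDiff (n := ⊤)).comp (contDiff_const.sub contDiff_id)

theorem angularVelocity_eq_zero_iff {ε s : ℝ} : angularVelocity ε s = 0 ↔ ε ^ 2 ≤ s := by
  rw [angularVelocity, expNegInvGlue.zero_iff_nonpos, sub_nonpos]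

/-- The pressure which balances the centrifugal force of `angularVelocity ε`, as a function of the
squared distance `s` to the centre; it is normalized to vanish outside the disk. -/
def radialPressure (ε s : ℝ) : ℝ := ∫ t in (ε ^ 2)..s, angularVelocity ε t ^ 2 / 2

theorem hasDerivAt_radialPressure (ε s : ℝ) :
    HasDerivAt (radialPressure ε) (angularVelocity ε s ^ 2 / 2) s :=
  ((((contDiff_angularVelocity ε).continuous.pow 2).div_const 2).integral_hasStrictDerivAt
    (ε ^ 2) s).hasDerivAt

theorem contDiff_radialPressure (ε : ℝ) : ContDiff ℝ ∞ (radialPressure ε) := by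
  rw [contDiff_infty_iff_deriv]
  refine ⟨fun s => (hasDerivAt_radialPressure ε s).differentiableAt, ?_⟩
  rw [funext fun s => (hasDerivAt_radialPressure ε s).deriv]
  exact ((contDiff_angularVelocity ε).pow 2).div_const 2

theorem radialPressure_eq_zero {ε s : ℝ} (h : ε ^ 2 ≤ s) : radialPressure ε s = 0 := by
  refine intervalIntegral.integral_zero_ae (Eventually.of_forall fun t ht => ?_)
  rw [Set.uIoc_of_le h] at ht
  rw [angularVelocity_eq_zero_iff.2 ht.1.le, zero_pow two_ne_zero, zero_div]

variable (a l : Fin d) (ε : ℝ)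

/-- The flow on `ℝᵈ` which rotates the planes of the coordinates `a`, `l` about the origin with the
angular velocity `angularVelocity ε`. -/
def circularFlow (x : Space d) : Space d :=
  angularVelocity ε (x a ^ 2 + x l ^ 2) •
    (x l • EuclideanSpace.single a (1 : ℝ) - x a • EuclideanSpace.single l (1 : ℝ))

/-- The pressure of `circularFlow`. -/
def circularPressure (x : Space d) : ℝ := radialPressure ε (x a ^ 2 + x l ^ 2)

theorem contDiff_coord (i : Fin d) : ContDiff ℝ ∞ fun x : Space d => x i :=
  (EuclideanSpace.proj i : Space d →L[ℝ] ℝ).contDiff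

theorem contDiff_circularFlow : ContDiff ℝ ∞ (circularFlow a l ε) :=
  ((contDiff_angularVelocity ε).comp
    (((contDiff_coord a).pow 2).add ((contDiff_coord l).pow 2))).smul
    (((contDiff_coord l).smul contDiff_const).sub ((contDiff_coord a).smul contDiff_const))

theorem contDiff_circularPressure : ContDiff ℝ ∞ (circularPressure a l ε) :=
  (contDiff_radialPressure ε).comp (((contDiff_coord a).pow 2).add ((contDiff_coord l).pow 2))

theorem hasFDerivAt_coord (i : Fin d) (x : Space d) :
    HasFDerivAt (fun x : Space d => x i) (EuclideanSpace.proj i : Space d →L[ℝ] ℝ) x :=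
  (EuclideanSpace.proj i : Space d →L[ℝ] ℝ).hasFDerivAt

theorem gradient_apply (f : Space d → ℝ) (x : Space d) (i : Fin d) :
    gradient f x i = fderiv ℝ f x (EuclideanSpace.single i 1) := by
  rw [← inner_gradient_left, EuclideanSpace.inner_single_right]
  simp

theorem fderiv_circularFlow (x v : Space d) :
    fderiv ℝ (circularFlow a l ε) x v =
      (deriv (angularVelocity ε) (x a ^ 2 + x l ^ 2) * (2 * (x a * v a + x l * v l))) •
        (x l • EuclideanSpace.single a (1 : ℝ) - x a • EuclideanSpace.single l (1 : ℝ)) +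
      angularVelocity ε (x a ^ 2 + x l ^ 2) •
        (v l • EuclideanSpace.single a (1 : ℝ) - v a • EuclideanSpace.single l (1 : ℝ)) := by
  have h_angular := ((contDiff_angularVelocity ε).differentiable (by simp)
    (x a ^ 2 + x l ^ 2)).hasDerivAt.comp_hasFDerivAt x
      (((hasFDerivAt_coord a x).pow 2).add ((hasFDerivAt_coord l x).pow 2))
  have h_rotation := ((hasFDerivAt_coord l x).smul_const (EuclideanSpace.single a (1 : ℝ))).sub
    ((hasFDerivAt_coord a x).smul_const (EuclideanSpace.single l (1 : ℝ)))
  have h_flow : HasFDerivAt (circularFlow a l ε) _ x := h_angular.smul h_rotation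
  rw [h_flow.fderiv]
  simp only [add_apply, smul_apply, sub_apply, ContinuousLinearMap.smulRight_apply,
    PiLp.proj_apply, smul_eq_mul, Function.comp_apply, Pi.add_apply]
  rw [add_comm]
  congr 2
  simp only [nsmul_eq_mul, Nat.cast_ofNat, Nat.add_one_sub_one, pow_one]
  ring

variable {a l ε}

theorem circularFlow_eq_zero_iff (hal : a ≠ l) {x : Space d} :
    circularFlow a l ε x = 0 ↔ ε ^ 2 ≤ x a ^ 2 + x l ^ 2 ∨ x a = 0 ∧ x l = 0 := by
  rw [circularFlow, smul_eq_zero, angularVelocity_eq_zero_iff, sub_eq_zero]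
  refine or_congr_right ⟨fun h => ⟨?_, ?_⟩, fun h => by rw [h.1, h.2, zero_smul, zero_smul]⟩
  · simpa [hal.symm, eq_comm] using congrArg (fun y : Space d => y l) h
  · simpa [hal] using congrArg (fun y : Space d => y a) h

theorem divergence_circularFlow (hal : a ≠ l) (x : Space d) :
    divergence (circularFlow a l ε) x = 0 := by
  simp only [divergence, fderiv_circularFlow, PiLp.add_apply, PiLp.smul_apply, PiLp.sub_apply,
    PiLp.single_apply, smul_eq_mul, mul_ite, mul_one, mul_zero, mul_sub, mul_add, add_mul,
    Finset.sum_add_distrib, Finset.sum_sub_distrib, Finset.sum_ite_eq',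
    Finset.mem_univ, if_true]
  simp only [hal, hal.symm, if_false, zero_mul, add_zero, zero_add, sub_self]
  ring

theorem euler_circularFlow (hal : a ≠ l) (x : Space d) :
    fderiv ℝ (circularFlow a l ε) x (circularFlow a l ε x) +
      gradient (circularPressure a l ε) x = 0 := by
  have h_pressure : HasFDerivAt (circularPressure a l ε) _ x :=
    (hasDerivAt_radialPressure ε (x a ^ 2 + x l ^ 2)).comp_hasFDerivAt x
      (((hasFDerivAt_coord a x).pow 2).add ((hasFDerivAt_coord l x).pow 2))
  have ha : circularFlow a l ε x a = angularVelocity ε (x a ^ 2 + x l ^ 2) * x l := by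
    simp [circularFlow, hal]
  have hl : circularFlow a l ε x l = -(angularVelocity ε (x a ^ 2 + x l ^ 2) * x a) := by
    simp [circularFlow, hal.symm]
  ext i
  rw [PiLp.add_apply, gradient_apply, fderiv_circularFlow, ha, hl, h_pressure.fderiv]
  simp only [PiLp.add_apply, PiLp.smul_apply, PiLp.sub_apply, PiLp.zero_apply,
    PiLp.single_apply, PiLp.proj_apply, add_apply, smul_apply, smul_eq_mul, nsmul_eq_mul,
    Nat.cast_ofNat, Nat.add_one_sub_one, pow_one, eq_comm (a := a), eq_comm (a := l)]
  split_ifs <;> ring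

end CircularFlow

section Vortex

variable {d : ℕ} {a l : Fin d} {ε : ℝ}

theorem sq_le_sum_sq {x : Space d} {i : Fin d} (hi : i ∈ ({a, l} : Set (Fin d)))
    (h : |ε| ≤ |x i|) : ε ^ 2 ≤ x a ^ 2 + x l ^ 2 := by
  have h_sq := sq_le_sq.2 h
  rcases hi with hi | hi <;> rw [hi] at h_sq <;> linarith [sq_nonneg (x a), sq_nonneg (x l)]

theorem circularFlow_congr (x y : Space d) (h : ∀ i ∈ ({a, l} : Set (Fin d)), x i = y i) :
    circularFlow a l ε x = circularFlow a l ε y := by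
  rw [circularFlow, circularFlow, h a (.inl rfl), h l (.inr rfl)]

theorem circularFlow_eq_zero (x : Space d) (i : Fin d) (hi : i ∈ ({a, l} : Set (Fin d)))
    (h : |ε| ≤ |x i|) : circularFlow a l ε x = 0 := by
  rw [circularFlow, angularVelocity_eq_zero_iff.2 (sq_le_sum_sq hi h), zero_smul]

theorem circularPressure_congr (x y : Space d) (h : ∀ i ∈ ({a, l} : Set (Fin d)), x i = y i) :
    circularPressure a l ε x = circularPressure a l ε y := by
  rw [circularPressure, circularPressure, h a (.inl rfl), h l (.inr rfl)]

theorem circularPressure_eq_zero (x : Space d) (i : Fin d) (hi : i ∈ ({a, l} : Set (Fin d)))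
    (h : |ε| ≤ |x i|) : circularPressure a l ε x = 0 :=
  radialPressure_eq_zero (sq_le_sum_sq hi h)

/-- The circular flow of radius `|ε|` about `0 ∈ 𝕋ᵈ` in the planes of the coordinates `a`, `l`. -/
def vortex (hal : a ≠ l) (hε : |ε| < Real.pi) : SVect d :=
  ⟨fun X => circularFlow a l ε (rep X),
    contDiff_comp_rep_proj hε circularFlow_congr circularFlow_eq_zero
      (contDiff_circularFlow a l ε), fun x => by
      rw [divergence, fderiv_comp_rep_proj hε circularFlow_congr circularFlow_eq_zero]
      exact divergence_circularFlow hal _⟩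

theorem contDiff_vortexPressure (hε : |ε| < Real.pi) :
    ContDiff ℝ ∞ fun x => circularPressure a l ε (rep (proj x)) :=
  contDiff_comp_rep_proj hε circularPressure_congr circularPressure_eq_zero
    (contDiff_circularPressure a l ε)

variable (hal : a ≠ l) (hε : |ε| < Real.pi)

theorem euler_vortex (x : Space d) :
    fderiv ℝ (vortex hal hε).lift x ((vortex hal hε).lift x) +
      gradient (fun y => circularPressure a l ε (rep (proj y))) x = 0 := by
  have h_flow : fderiv ℝ (vortex hal hε).lift x = fderiv ℝ (circularFlow a l ε) (rep (proj x)) :=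
    fderiv_comp_rep_proj hε circularFlow_congr circularFlow_eq_zero x
  rw [h_flow, gradient, fderiv_comp_rep_proj hε circularPressure_congr circularPressure_eq_zero]
  exact euler_circularFlow hal (rep (proj x))

theorem vortex_eq_zero_iff {X : Torus d} :
    vortex hal hε X = 0 ↔ ε ^ 2 ≤ ‖X a‖ ^ 2 + ‖X l‖ ^ 2 ∨ X a = 0 ∧ X l = 0 := by
  have h_zero (i : Fin d) : rep X i = 0 ↔ X i = 0 := by
    rw [← abs_eq_zero, abs_rep_apply, norm_eq_zero]
  rw [← abs_rep_apply, ← abs_rep_apply, sq_abs, sq_abs, ← h_zero, ← h_zero]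
  exact circularFlow_eq_zero_iff hal

theorem norm_apply_lt_of_vortex_ne_zero {X : Torus d} (hX : vortex hal hε X ≠ 0) :
    ‖X l‖ < |ε| := by
  rw [Ne, vortex_eq_zero_iff, not_or, not_le] at hX
  rw [← abs_norm]
  exact sq_lt_sq.1 (by linarith [hX.1, sq_nonneg ‖X a‖])

theorem eq_zero_of_translate_vortex_eq (h0 : ε ≠ 0) {b : Torus d} (hbl : b l = 0)
    (hb : SVect.translate b (vortex hal hε) = vortex hal hε) : b a = 0 := by
  have h_apply (X : Torus d) : vortex hal hε (X - b) = vortex hal hε X :=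
    congrArg (fun u : SVect d => u X) hb
  have h_origin : vortex hal hε b = 0 := by
    rw [← h_apply, sub_self, vortex_eq_zero_iff]
    exact .inr ⟨rfl, rfl⟩
  rw [vortex_eq_zero_iff, hbl, norm_zero, zero_pow two_ne_zero, add_zero] at h_origin
  refine (h_origin.resolve_left fun h_far => ?_).1
  set X : Torus d := proj (EuclideanSpace.single l (ε / 2)) with hX
  have h_norm : ‖X l‖ = |ε / 2| := by
    rw [hX, proj_single, Pi.single_eq_same, AddCircle.norm_coe_eq_abs_iff _ Real.two_pi_pos.ne',
      abs_of_pos Real.two_pi_pos, abs_div, abs_two]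
    linarith [abs_nonneg ε]
  have h_ne : vortex hal hε X ≠ 0 := by
    have hXa : X a = 0 := by rw [hX, proj_single, Pi.single_eq_of_ne hal]
    have hε2 : 0 < ε ^ 2 := by positivity
    rw [Ne, vortex_eq_zero_iff, hXa, h_norm, sq_abs, norm_zero, ← norm_eq_zero (a := X l), h_norm]
    simp only [abs_eq_zero, div_eq_zero_iff, h0, two_ne_zero, or_self, and_false, or_false, not_le]
    nlinarith
  have h_zero : vortex hal hε (X + b) = 0 := by
    have h_sum : (X + b) a = b a := by
      rw [Pi.add_apply, hX, proj_single, Pi.single_eq_of_ne hal, zero_add]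
    rw [vortex_eq_zero_iff, h_sum]
    exact .inl (by linarith [h_far, sq_nonneg ‖(X + b) l‖])
  exact h_ne (by rw [← h_zero, ← h_apply (X + b), add_sub_cancel_right])

theorem exists_translate_vortex_ne (h0 : ε ≠ 0) {v : Space d} (hvl : v l = 0) (hva : v a ≠ 0) :
    ∃ s : ℝ, SVect.translate (proj (s • v)) (vortex hal hε) ≠ vortex hal hε := by
  refine ⟨Real.pi / v a, fun h => ?_⟩
  have h_zero : ((Real.pi : ℝ) : AddCircle (2 * Real.pi)) = 0 := by
    simpa [proj, hva] using eq_zero_of_translate_vortex_eq hal hε h0 (by simp [proj, hvl]) h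
  have h_norm : ‖((Real.pi : ℝ) : AddCircle (2 * Real.pi))‖ = |Real.pi| := by
    rw [AddCircle.norm_coe_eq_abs_iff _ Real.two_pi_pos.ne', abs_of_pos Real.two_pi_pos,
      abs_of_pos Real.pi_pos]
    linarith
  rw [h_zero, norm_zero] at h_norm
  exact Real.pi_ne_zero (abs_eq_zero.1 h_norm.symm)

end Vortex

section Shear

variable {d : ℕ} {a l : Fin d} (hal : a ≠ l) (f : AddCircle (2 * Real.pi) → ℝ)
  (hf : ContDiff ℝ ∞ fun y : ℝ => f y)

include hf in
theorem hasFDerivAt_shear (a l : Fin d) (x : Space d) :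
    HasFDerivAt (fun x : Space d => f (proj x l) • EuclideanSpace.single a (1 : ℝ))
      ((deriv (fun y : ℝ => f y) (x l) • (EuclideanSpace.proj l : Space d →L[ℝ] ℝ)).smulRight
        (EuclideanSpace.single a (1 : ℝ))) x :=
  ((hf.differentiable (by simp) (x l)).hasDerivAt.comp_hasFDerivAt x
    (hasFDerivAt_coord l x)).smul_const _

/-- The shear flow `f(x_l) e_a`. -/
def shear : SVect d :=
  ⟨fun X => f (X l) • EuclideanSpace.single a (1 : ℝ),
    (hf.comp (contDiff_coord l)).smul contDiff_const, fun x =>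
      Finset.sum_eq_zero fun i _ => by
        rw [(hasFDerivAt_shear f hf a l x).fderiv]
        rcases eq_or_ne i l with rfl | hi
        · simp [hal.symm]
        · simp [hi.symm]⟩

theorem shear_apply (X : Torus d) :
    shear hal f hf X = f (X l) • EuclideanSpace.single a (1 : ℝ) := rfl

theorem fderiv_shear_apply_self (x : Space d) :
    fderiv ℝ (shear hal f hf).lift x ((shear hal f hf).lift x) = 0 := by
  have h_deriv : HasFDerivAt (shear hal f hf).lift _ x := hasFDerivAt_shear f hf a l x
  rw [h_deriv.fderiv]
  simp [SVect.lift, shear_apply, hal.symm]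

theorem translate_shear {b : Torus d} (hb : b l = 0) :
    SVect.translate b (shear hal f hf) = shear hal f hf := by
  ext1 X
  rw [SVect.translate_apply, shear_apply, shear_apply, Pi.sub_apply, hb, sub_zero]

end Shear

section Plateau

theorem cos_norm_coe (x : ℝ) : Real.cos ‖(x : AddCircle (2 * Real.pi))‖ = Real.cos x := by
  rw [AddCircle.norm_eq, Real.cos_abs, Real.cos_sub_int_mul_two_pi]

/-- A smooth function on the circle which is `1` at distance at most `ε` from the origin, and `0` at
distance at least `2 * ε`. -/
def plateau (ε : ℝ) (Y : AddCircle (2 * Real.pi)) : ℝ :=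
  Real.smoothTransition
    ((Real.cos ‖Y‖ - Real.cos (2 * ε)) / (Real.cos ε - Real.cos (2 * ε)))

theorem contDiff_plateau (ε : ℝ) (Y : AddCircle (2 * Real.pi)) :
    ContDiff ℝ ∞ fun x : ℝ => plateau ε (x - Y) := by
  obtain ⟨y, rfl⟩ := QuotientAddGroup.mk_surjective Y
  simp only [plateau, ← AddCircle.coe_sub, cos_norm_coe]
  exact (Real.smoothTransition.contDiff (n := ⊤)).comp
    (((Real.contDiff_cos.comp (contDiff_id.sub contDiff_const)).sub contDiff_const).div_const _)

variable {ε : ℝ} (h0 : 0 < ε) (hε : 2 * ε < Real.pi) {Y : AddCircle (2 * Real.pi)}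

include h0 hε

theorem cos_two_mul_lt_cos : Real.cos (2 * ε) < Real.cos ε :=
  Real.cos_lt_cos_of_nonneg_of_le_pi h0.le hε.le (by linarith)

theorem plateau_eq_one (hY : ‖Y‖ ≤ ε) : plateau ε Y = 1 := by
  refine Real.smoothTransition.one_of_one_le ((one_le_div ?_).2 ?_)
  · exact sub_pos.2 (cos_two_mul_lt_cos h0 hε)
  · exact sub_le_sub_right
      (Real.cos_le_cos_of_nonneg_of_le_pi (norm_nonneg Y) (by linarith) hY) _

theorem plateau_eq_zero (hY : 2 * ε ≤ ‖Y‖) : plateau ε Y = 0 := by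
  have h_pi : ‖Y‖ ≤ Real.pi := by
    have h_half := AddCircle.norm_le_half_period (2 * Real.pi) Real.two_pi_pos.ne' (x := Y)
    rw [abs_of_pos Real.two_pi_pos] at h_half
    linarith
  refine Real.smoothTransition.zero_of_nonpos (div_nonpos_of_nonpos_of_nonneg ?_ ?_)
  · exact sub_nonpos.2 (Real.cos_le_cos_of_nonneg_of_le_pi (by linarith) h_pi hY)
  · exact sub_nonneg.2 (cos_two_mul_lt_cos h0 hε).le

end Plateau

section Strips

variable {d : ℕ} {ι : Type*} {l : Fin d} {ε : ℝ}

theorem exists_separated_heights (ι : Type*) [Finite ι] :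
    ∃ (h : ι → ℝ) (ε : ℝ), 0 < ε ∧ 2 * ε < Real.pi ∧
      ∀ i j, i ≠ j → 3 * ε ≤ ‖((h i : AddCircle (2 * Real.pi)) - h j)‖ := by
  obtain ⟨n, ⟨e⟩⟩ := Finite.exists_equiv_fin ι
  set ε : ℝ := Real.pi / (3 * (n + 1)) with hε
  have h0 : 0 < ε := by positivity
  have h_total : 3 * ε * (n + 1) = Real.pi := by rw [hε]; field_simp
  refine ⟨fun i => 3 * ε * (e i : ℤ), ε, h0, by nlinarith, fun i j hij => ?_⟩
  have h_one : (1 : ℝ) ≤ |((e i : ℤ) : ℝ) - (e j : ℤ)| := by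
    have h_ne : ((e i : ℕ) : ℤ) - (e j : ℕ) ≠ 0 := by
      rwa [sub_ne_zero, Nat.cast_injective.ne_iff, Fin.val_ne_iff, e.injective.ne_iff]
    exact_mod_cast Int.one_le_abs h_ne
  have h_le : |((e i : ℤ) : ℝ) - (e j : ℤ)| ≤ n + 1 := by
    have hi : ((e i : ℕ) : ℝ) ≤ n := by exact_mod_cast (e i).2.le
    have hj : ((e j : ℕ) : ℝ) ≤ n := by exact_mod_cast (e j).2.le
    rw [Int.cast_natCast, Int.cast_natCast, abs_le]
    constructor <;> linarith [(e i : ℕ).cast_nonneg (α := ℝ), (e j : ℕ).cast_nonneg (α := ℝ)]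
  have h_abs : |3 * ε * ((e i : ℤ) : ℝ) - 3 * ε * (e j : ℤ)| =
      3 * ε * |((e i : ℤ) : ℝ) - (e j : ℤ)| := by
    rw [← mul_sub, abs_mul, abs_of_pos (by positivity)]
  rw [← AddCircle.coe_sub, (AddCircle.norm_coe_eq_abs_iff _ Real.two_pi_pos.ne').2, h_abs]
  · exact le_mul_of_one_le_right (by positivity) h_one
  · rw [h_abs, abs_of_pos Real.two_pi_pos]
    nlinarith

/-- The field `u` vanishes outside the strip `‖X l‖ ≤ ε`. -/
def SupportedInStrip (l : Fin d) (ε : ℝ) (u : SVect d) : Prop :=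
  ∀ X, ε < ‖X l‖ → u X = 0

theorem SupportedInStrip.dirDeriv {u : SVect d} (hu : SupportedInStrip l ε u) (v : Space d) :
    SupportedInStrip l ε (SVect.dirDeriv v u) := by
  intro X hX
  obtain ⟨x, rfl⟩ := isOpenQuotientMap_proj.surjective X
  have h_near : u.lift =ᶠ[𝓝 x] fun _ => 0 := by
    have h_norm : Continuous fun x : Space d => ‖proj x l‖ :=
      ((continuous_apply l).comp isOpenQuotientMap_proj.continuous).norm
    filter_upwards [h_norm.continuousAt.eventually_const_lt hX] with y hy using hu _ hy
  have h_lift : SVect.dirDeriv v u (proj x) = fderiv ℝ u.lift x v :=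
    congrFun (SVect.lift_dirDeriv v u) x
  rw [h_lift, h_near.fderiv_eq, fderiv_fun_const, Pi.zero_apply, zero_apply]

theorem supportedInStrip_vortex {a : Fin d} (hal : a ≠ l) (hε : |ε| < Real.pi) :
    SupportedInStrip l |ε| (vortex hal hε) := fun _ hX =>
  by_contra fun h => (norm_apply_lt_of_vortex_ne_zero hal hε h).not_gt hX

theorem eq_of_norm_sub_le {E : Type*} [SeminormedAddCommGroup E] {h : ι → E}
    (hsep : ∀ i j, i ≠ j → 2 * ε < ‖h i - h j‖) {Y : E} {i j : ι}
    (hi : ‖Y - h i‖ ≤ ε) (hj : ‖Y - h j‖ ≤ ε) : i = j := by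
  by_contra hij
  have h_tri := norm_sub_le_norm_sub_add_norm_sub (h i) Y (h j)
  rw [norm_sub_rev (h i) Y] at h_tri
  linarith [hsep i j hij]

variable [Fintype ι] {C : SVect d} {V V' : ι → SVect d} {b b' : ι → Torus d}

theorem superposition_add_apply (hV : ∀ i, SupportedInStrip l ε (V i))
    (hsep : ∀ i j, i ≠ j → 2 * ε < ‖b i l - b j l‖) {X : Torus d} (hX : ‖X l‖ ≤ ε) (i : ι) :
    superposition C V b (X + b i) = C (X + b i) + V i X := by
  have h_single : ∑ j, V j (X + b i - b j) = V i (X + b i - b i) :=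
    Fintype.sum_eq_single i fun j hj => hV j _ <| not_le.1 fun hle => hj <|
      eq_of_norm_sub_le (h := fun i => b i l) (Y := X l + b i l) hsep hle
        (by rwa [add_sub_cancel_right])
  rw [superposition_apply, h_single, add_sub_cancel_right]

theorem eq_translate_of_superposition_eq (hV : ∀ i, SupportedInStrip l ε (V i))
    (hV' : ∀ i, SupportedInStrip l ε (V' i)) (hsep : ∀ i j, i ≠ j → 2 * ε < ‖b i l - b j l‖)
    (hb : ∀ i, b' i l = b i l) (h : superposition C V b = superposition C V' b') (i : ι) :
    V i = SVect.translate (b' i - b i) (V' i) := by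
  ext1 X
  rw [SVect.translate_apply]
  have h_height : (X - (b' i - b i)) l = X l := by simp [hb]
  rcases le_or_gt ‖X l‖ ε with hX | hX
  · have h_add : X + b i = X - (b' i - b i) + b' i := by abel
    refine add_left_cancel (a := C (X + b i)) ?_
    rw [← superposition_add_apply hV hsep hX, h, h_add]
    exact superposition_add_apply hV' (by simpa only [hb] using hsep) (by rwa [h_height]) i
  · rw [hV i X hX, hV' i (X - (b' i - b i)) (by rwa [h_height])]

end Strips

section VortexArray

variable {d N : ℕ} {a l : Fin d}

/-- The index set of the vortices: a moving vortex for each coordinate of `𝕋ᴺ`, and a fixed one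
for each coordinate of `𝕋ᵈ` other than `l`. -/
abbrev VortexIndex (N : ℕ) (l : Fin d) : Type := Fin N ⊕ {k : Fin d // k ≠ l}

/-- The `i`-th vortex rotates the planes of the coordinates `axis a i` and `l`. -/
def axis (a : Fin d) : VortexIndex N l → Fin d := Sum.elim (fun _ => a) Subtype.val

theorem axis_ne (hal : a ≠ l) : ∀ i : VortexIndex N l, axis a i ≠ l
  | .inl _ => hal
  | .inr k => k.2

/-- The displacement of the `i`-th vortex when the parameter in `𝕋ᴺ` moves by a given vector. -/
def displacement (a : Fin d) : VortexIndex N l → Space N →L[ℝ] Space d :=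
  Sum.elim (fun j => (EuclideanSpace.proj j).smulRight (EuclideanSpace.single a 1)) 0

theorem displacement_inl_apply (j : Fin N) (x : Space N) :
    displacement a (.inl j : VortexIndex N l) x = x j • EuclideanSpace.single a (1 : ℝ) := rfl

/-- The position of the `i`-th vortex, at the height `h i` in the coordinate `l`. -/
def centre (a : Fin d) (h : VortexIndex N l → ℝ) (θ : Torus N) (i : VortexIndex N l) : Torus d :=
  Pi.single l (h i : AddCircle (2 * Real.pi)) + Pi.single a (Sum.elim θ 0 i)

variable {h : VortexIndex N l → ℝ}

theorem centre_apply_height (hal : a ≠ l) (θ : Torus N) (i : VortexIndex N l) :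
    centre a h θ i l = h i := by
  rw [centre, Pi.add_apply, Pi.single_eq_same, Pi.single_eq_of_ne hal.symm, add_zero]

theorem centre_inl_apply (hal : a ≠ l) (θ : Torus N) (j : Fin N) :
    centre a h θ (.inl j) a = θ j := by
  rw [centre, Pi.add_apply, Pi.single_eq_of_ne hal, Pi.single_eq_same, zero_add, Sum.elim_inl]

theorem centre_add_proj (θ : Torus N) (x : Space N) (i : VortexIndex N l) :
    centre a h (θ + proj x) i = centre a h θ i + proj (displacement a i x) := by
  rcases i with j | k
  · have h_proj : proj (x j • EuclideanSpace.single a (1 : ℝ)) =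
        Pi.single a (x j : AddCircle (2 * Real.pi)) := by
      ext i
      rcases eq_or_ne i a with rfl | hi <;> simp [proj, *]
    rw [displacement_inl_apply, h_proj, centre, centre, add_assoc, ← Pi.single_add]
    rfl
  · simp [centre, displacement]

theorem continuous_centre : Continuous (centre a h : Torus N → VortexIndex N l → Torus d) := by
  refine continuous_pi fun i => continuous_const.add ((continuous_single a).comp ?_)
  rcases i with j | _
  · exact continuous_apply j
  · exact continuous_const

/-- The velocity of the shear flow as a function of the height: the `j`-th moving vortex lies in a
strip in which it equals `ν j`. -/
def speedProfile (h : VortexIndex N l → ℝ) (ε : ℝ) (ν : Space N) (Y : AddCircle (2 * Real.pi)) :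
    ℝ := ∑ j, ν j * plateau ε (Y - h (.inl j))

theorem contDiff_speedProfile (h : VortexIndex N l → ℝ) (ε : ℝ) (ν : Space N) :
    ContDiff ℝ ∞ fun y : ℝ => speedProfile h ε ν y :=
  ContDiff.sum fun _ _ => contDiff_const.mul (contDiff_plateau ε _)

/-- The shear flow which carries the vortices. -/
def backgroundShear (hal : a ≠ l) (h : VortexIndex N l → ℝ) (ε : ℝ) (ν : Space N) : SVect d :=
  shear hal (speedProfile h ε ν) (contDiff_speedProfile h ε ν)

/-- The quasi-periodic family: the background shear flow with a vortex at each of the centres. -/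
def vortexArray (hal : a ≠ l) (h : VortexIndex N l → ℝ) {ε : ℝ} (hε : |ε| < Real.pi)
    (ν : Space N) (θ : Torus N) : SVect d :=
  superposition (backgroundShear hal h ε ν) (fun i => vortex (axis_ne hal i) hε) (centre a h θ)

variable {ε : ℝ} (hal : a ≠ l) (h0 : 0 < ε) (hε : 2 * ε < Real.pi) (hε' : |ε| < Real.pi)
  (hsep : ∀ i j, i ≠ j → 3 * ε ≤ ‖(h i : AddCircle (2 * Real.pi)) - h j‖) (ν : Space N)

theorem centre_proj (x : Space N) :
    centre a h (proj x) = fun i => proj (EuclideanSpace.single l (h i) + displacement a i x) := by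
  have h_zero (i : VortexIndex N l) :
      centre a h (0 : Torus N) i = proj (EuclideanSpace.single l (h i)) := by
    rw [proj_single, centre]
    rcases i <;> simp
  funext i
  rw [proj_add, ← h_zero, ← centre_add_proj, zero_add]

include hal h0 hsep

theorem two_mul_abs_lt_norm_centre_sub (θ : Torus N) (i j : VortexIndex N l) (hij : i ≠ j) :
    2 * |ε| < ‖centre a h θ i l - centre a h θ j l‖ := by
  rw [centre_apply_height hal, centre_apply_height hal, abs_of_pos h0]
  linarith [hsep i j hij]

theorem injective_vortexArray : Function.Injective (vortexArray hal h hε' ν) := by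
  intro θ θ' heq
  funext j
  have h_vortex := eq_translate_of_superposition_eq
    (fun i => supportedInStrip_vortex (axis_ne hal i) hε')
    (fun i => supportedInStrip_vortex (axis_ne hal i) hε')
    (two_mul_abs_lt_norm_centre_sub hal h0 hsep θ)
    (fun i => by rw [centre_apply_height hal, centre_apply_height hal]) heq (.inl j)
  have h_diff := eq_zero_of_translate_vortex_eq (axis_ne hal (.inl j)) hε' h0.ne'
    (by rw [Pi.sub_apply, centre_apply_height hal, centre_apply_height hal, sub_self])
    h_vortex.symm
  rwa [axis, Sum.elim_inl, Pi.sub_apply, centre_inl_apply hal, centre_inl_apply hal,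
    sub_eq_zero, eq_comm] at h_diff

theorem superposition_dirDeriv_vortex_ne_zero (θ : Torus N) {v : Space N} (hv : v ≠ 0) :
    superposition 0 (fun i => SVect.dirDeriv (-displacement a i v) (vortex (axis_ne hal i) hε'))
      (centre a h θ) ≠ 0 := by
  intro h_zero
  obtain ⟨j, hj⟩ : ∃ j, v j ≠ 0 := by
    by_contra! h_all
    exact hv (PiLp.ext h_all)
  have h_dirDeriv := eq_translate_of_superposition_eq (C := 0) (V' := fun _ => 0)
    (fun i => (supportedInStrip_vortex (axis_ne hal i) hε').dirDeriv (-displacement a i v))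
    (fun _ _ _ => rfl) (two_mul_abs_lt_norm_centre_sub hal h0 hsep θ) (fun _ => rfl)
    (h_zero.trans (by ext1 X; simp [superposition])) (.inl j)
  obtain ⟨s, hs⟩ := exists_translate_vortex_ne (axis_ne hal (.inl j : VortexIndex N l)) hε' h0.ne'
    (v := -displacement a (.inl j : VortexIndex N l) v)
    (by simp [displacement_inl_apply, hal.symm]) (by simpa [displacement_inl_apply, axis] using hj)
  exact hs (SVect.translate_eq_of_dirDeriv_eq_zero (h_dirDeriv.trans (SVect.ext fun _ => rfl)) s)

theorem isSmoothEmbedding_vortexArray : IsSmoothEmbedding (vortexArray hal h hε' ν) where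
  smooth k := by
    simp only [vortexArray, centre_proj]
    exact isCk_superposition _ _ _ _ k
  immersion x v hv := by
    have h_deriv := hasDirDeriv_superposition (backgroundShear hal h ε ν)
      (fun i => vortex (axis_ne hal i) hε') (fun i => EuclideanSpace.single l (h i))
      (displacement a) x v
    simp only [← centre_proj] at h_deriv
    exact ⟨_, superposition_dirDeriv_vortex_ne_zero hal h0 hε' hsep (proj x) hv, h_deriv⟩
  isEmbedding := (((continuous_superposition _ _).comp continuous_centre).isClosedEmbedding
    (injective_vortexArray hal h0 hε' hsep ν)).isEmbedding

omit h0 hsep in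
theorem translate_vortexArray {b : Torus d} (hb : b l = 0) (θ : Torus N) :
    SVect.translate b (vortexArray hal h hε' ν θ) = superposition (backgroundShear hal h ε ν)
      (fun i => vortex (axis_ne hal i) hε') (fun i => b + centre a h θ i) := by
  ext1 X
  have h_shear := congrArg (fun u : SVect d => u X)
    (translate_shear hal (speedProfile h ε ν) (contDiff_speedProfile h ε ν) hb)
  rw [SVect.translate_apply, vortexArray, superposition_apply, superposition_apply]
  simp only [sub_sub]
  congr 1

theorem exists_translate_vortexArray_ne (θ : Torus N) {v : Space d} (hvl : v l = 0)
    (hv : v ≠ 0) :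
    ∃ s : ℝ, SVect.translate (proj (s • v)) (vortexArray hal h hε' ν θ) ≠
      vortexArray hal h hε' ν θ := by
  obtain ⟨k, hk⟩ : ∃ k, v k ≠ 0 := by
    by_contra! h_all
    exact hv (PiLp.ext h_all)
  have hkl : k ≠ l := fun h_eq => hk (h_eq ▸ hvl)
  obtain ⟨s, hs⟩ := exists_translate_vortex_ne hkl hε' h0.ne' hvl hk
  refine ⟨s, fun h_inv => hs ?_⟩
  have hsv : proj (s • v) l = 0 := by simp [proj, hvl]
  rw [translate_vortexArray hal hε' ν hsv] at h_inv
  have h_vortex := eq_translate_of_superposition_eq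
    (fun i => supportedInStrip_vortex (axis_ne hal i) hε')
    (fun i => supportedInStrip_vortex (axis_ne hal i) hε')
    (two_mul_abs_lt_norm_centre_sub hal h0 hsep θ)
    (fun i => by rw [Pi.add_apply, hsv, zero_add]) h_inv.symm (.inr ⟨k, hkl⟩)
  rw [add_sub_cancel_right] at h_vortex
  exact h_vortex.symm

include hε in
theorem exists_height_forall_vortexArray_eq (θ : Torus N) :
    ∃ Y c, ∀ X, X l = Y → vortexArray hal h hε' ν θ X = c := by
  let i : VortexIndex N l := .inr ⟨a, hal⟩
  have h_norm : ‖(ε : AddCircle (2 * Real.pi))‖ = ε := by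
    rw [(AddCircle.norm_coe_eq_abs_iff _ Real.two_pi_pos.ne').2, abs_of_pos h0]
    rw [abs_of_pos h0, abs_of_pos Real.two_pi_pos]
    linarith
  refine ⟨h i + ε, speedProfile h ε ν (h i + ε) • EuclideanSpace.single a 1, fun X hX => ?_⟩
  have h_vortex (j : VortexIndex N l) :
      vortex (axis_ne hal j) hε' (X - centre a h θ j) = 0 := by
    by_contra h_ne
    have h_lt := norm_apply_lt_of_vortex_ne_zero _ _ h_ne
    rw [Pi.sub_apply, centre_apply_height hal, hX, abs_of_pos h0] at h_lt
    rcases eq_or_ne i j with rfl | hij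
    · rw [add_sub_cancel_left, h_norm] at h_lt
      exact h_lt.false
    · have h_tri := norm_sub_le ((h i : AddCircle (2 * Real.pi)) + ε - h j) ε
      rw [add_sub_right_comm, add_sub_cancel_right, ← add_sub_right_comm, h_norm] at h_tri
      linarith [hsep i j hij]
  rw [vortexArray, superposition_apply, Finset.sum_eq_zero fun j _ => h_vortex j, add_zero,
    backgroundShear, shear_apply, hX]

include hε in
theorem isNonSymmetric_vortexArray : IsNonSymmetric (vortexArray hal h hε' ν) := by
  intro θ v hv h_inv
  by_cases hvl : v l = 0
  · obtain ⟨s, hs⟩ := exists_translate_vortexArray_ne hal h0 hε' hsep ν θ hvl hv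
    refine hs (SVect.ext fun X => ?_)
    rw [SVect.translate_apply, ← h_inv s, sub_add_cancel]
  · -- Moving every point to a height free of vortices shows that the field is constant.
    obtain ⟨Y, c, hc⟩ := exists_height_forall_vortexArray_eq hal h0 hε hε' hsep ν θ
    have h_const (X : Torus d) : vortexArray hal h hε' ν θ X = c := by
      obtain ⟨y, rfl⟩ := QuotientAddGroup.mk_surjective Y
      obtain ⟨x, rfl⟩ := isOpenQuotientMap_proj.surjective X
      rw [← h_inv ((y - x l) / v l)]
      refine hc _ ?_
      rw [← proj_add, proj, PiLp.add_apply, PiLp.smul_apply, smul_eq_mul, div_mul_cancel₀ _ hvl,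
        add_sub_cancel]
    obtain ⟨s, hs⟩ := exists_translate_vortexArray_ne hal h0 hε' hsep ν θ
      (v := EuclideanSpace.single a 1) (by simp [hal.symm]) (by simp)
    exact hs (SVect.ext fun X => by rw [SVect.translate_apply, h_const, h_const])

include hε in
theorem backgroundShear_apply_of_norm_sub_le {X : Torus d} {i : VortexIndex N l}
    (hX : ‖X l - h i‖ ≤ ε) : backgroundShear hal h ε ν X = displacement a i ν := by
  have h_far (j : VortexIndex N l) (hji : j ≠ i) : plateau ε (X l - h j) = 0 := by
    refine plateau_eq_zero h0 hε ?_
    have h_tri := norm_sub_le_norm_sub_add_norm_sub (h j : AddCircle (2 * Real.pi)) (X l) (h i)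
    rw [norm_sub_rev (h j : AddCircle (2 * Real.pi)) (X l)] at h_tri
    linarith [hsep j i hji]
  rw [backgroundShear, shear_apply, speedProfile]
  rcases i with j | k
  · rw [Fintype.sum_eq_single j fun j' hj' => by rw [h_far _ (by simpa using hj'), mul_zero],
      plateau_eq_one h0 hε hX, mul_one, displacement_inl_apply]
  · rw [Finset.sum_eq_zero fun j _ => by rw [h_far _ (by simp), mul_zero], zero_smul]
    rfl

include hε in
theorem isTheEulerSolution_vortexArray (θ : Torus N) :
    IsTheEulerSolution (vortexArray hal h hε' ν θ)
      (fun t : ℝ => vortexArray hal h hε' ν (θ + proj (t • ν))) := by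
  have h_centre (t : ℝ) : centre a h (θ + proj (t • ν)) =
      fun i => proj (rep (centre a h θ i) + t • displacement a i ν) := by
    funext i
    rw [centre_add_proj, proj_add, proj_rep, map_smul]
  have h_strip (i : VortexIndex N l) (t : ℝ) (X : Torus d)
      (hX : vortex (axis_ne hal i) hε'
        (X - proj (rep (centre a h θ i) + t • displacement a i ν)) ≠ 0) : ‖X l - h i‖ ≤ ε := by
    have h_lt := norm_apply_lt_of_vortex_ne_zero _ _ hX
    rw [← congrFun (h_centre t) i, Pi.sub_apply, centre_apply_height hal, abs_of_pos h0] at h_lt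
    exact h_lt.le
  have h_flow : IsEulerSolutionOn Set.univ
      fun t : ℝ => vortexArray hal h hε' ν (θ + proj (t • ν)) := by
    simp only [vortexArray, h_centre]
    exact isEulerSolutionOn_superposition
      (q := fun i X => circularPressure (axis a i) l ε (rep X))
      (fderiv_shear_apply_self hal _ _) (fun _ => contDiff_vortexPressure hε')
      (fun i => euler_vortex (axis_ne hal i) hε')
      (fun i t X hX => backgroundShear_apply_of_norm_sub_le hal h0 hε hsep ν (h_strip i t X hX))
      (fun i j t X hi hj => eq_of_norm_sub_le (h := fun i => (h i : AddCircle (2 * Real.pi)))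
        (fun i j hij => by linarith [hsep i j hij]) (h_strip i t X hi) (h_strip j t X hj))
  have h_solution := isTheEulerSolution_of_isEulerSolutionOn h_flow
  rwa [zero_smul, proj_zero, add_zero] at h_solution

end VortexArray

end EulerTorus

end

open EulerTorus in
theorem theorem1p1_general (d : ℕ) (hd : 2 ≤ d) (N : ℕ) (ν : Space N) :
    ∃ U : Torus N → SVect d, IsSmoothEmbedding U ∧ IsNonSymmetric U ∧
      ∀ θ : Torus N, IsTheEulerSolution (U θ) (fun t : ℝ => U (θ + proj (t • ν))) := by
  have hal : (⟨0, by omega⟩ : Fin d) ≠ ⟨1, hd⟩ := by simp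
  obtain ⟨h, ε, h0, hε, hsep⟩ := exists_separated_heights (VortexIndex N (⟨1, hd⟩ : Fin d))
  have hε' : |ε| < Real.pi := by rw [abs_of_pos h0]; linarith
  exact ⟨vortexArray hal h hε' ν, isSmoothEmbedding_vortexArray hal h0 hε' hsep ν,
    isNonSymmetric_vortexArray hal h0 hε hε' hsep ν,
    isTheEulerSolution_vortexArray hal h0 hε hε' hsep ν⟩

theorem theorem1p1 (d : ℕ) (hd : d = 3 ∨ (0 < d ∧ Even d)) (N : ℕ) (hN : 1 ≤ N)
    (ν : EulerTorus.Space N) (hν : ν ≠ 0) :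
    ∃ U : EulerTorus.Torus N → EulerTorus.SVect d,
      EulerTorus.IsSmoothEmbedding U ∧ EulerTorus.IsNonSymmetric U ∧
      ∀ θ : EulerTorus.Torus N,
        EulerTorus.IsTheEulerSolution (U θ) (fun t : ℝ => U (θ + EulerTorus.proj (t • ν))) :=
  theorem1p1_general d (by rcases hd with rfl | ⟨h_pos, h_even⟩ <;> grind) N ν
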